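/- Let $d\ge 1$. For measurable $f:\mathbb R^d\to\mathbb C$ let $f^*(t)=\inf\{\tau\ge 0:|\{x:|f(x)|>\tau\}|\le t\}$, and for $1\le p,s\le\infty$ put $$\|f\|_{L^{p,s}}=\Big(\int_0^\infty \big(t^{1/p}f^*(t)\big)^s\,\frac{dt}{t}\Big)^{1/s}\ (s<\infty),\qquad \|f\|_{L^{p,\infty}}=\sup_{t>0}t^{1/p}f^*(t);$$ $L^{p,s}$ is the set of measurable $f$ for which this is finite. For $1<p<\infty$ and $1\le s\le\infty$ the Fourier–Lorentz space $\mathcal L^{p,s}(\mathbb R^d)$ consists of the tempered distributions $u$ whose Fourier transform $\hat u$ is a function in $L^{p',s}(\mathbb R^d)$, where $1/p+1/p'=1$, with $\|u\|_{\mathcal L^{p,s}}=\|\hat u\|_{L^{p',s}}$. (The Fourier transform is normalized with the kernel $e^{-2\pi i x\cdot\xi}$; another normalization changes these norms only by constant factors depending on $d$ and $p$.) The product of two tempered distributions $u,v$ is the tempered distribution $uv=\lim_{\varepsilon\to0^+}(u*\varphi_\varepsilon)(v*\varphi_\varepsilon)$, with $\varphi_\varepsilon(x)=\varepsilon^{-d}\varphi(x/\varepsilon)$;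 it is said to exist if, for every Schwartz function $\varphi$ with $\int\varphi=1$, the limit exists in the sense of tempered distributions (tested against each Schwartz function), and it does not depend on $\varphi$. **Theorem 2.1** (Hölder's inequality in Fourier–Lorentz spaces). Let $1<r,q,\tilde q<\infty$ and $1\le h,\tilde h,\hat h\le\infty$ satisfy $$\frac1r=\frac1q+\frac1{\tilde q},\qquad \frac1h=\frac1{\tilde h}+\frac1{\hat h}.$$ There is a constant $C$, depending only on $d,r,q,\tilde q,h,\tilde h,\hat h$, such that for all $u\in\mathcal L^{q,\tilde h}(\mathbb R^d)$ and $v\in\mathcal L^{\tilde q,\hat h}(\mathbb R^d)$ the product $uv$ exists, belongs to $\mathcal L^{r,h}(\mathbb R^d)$, and $$\|uv\|_{\mathcal L^{r,h}}\le C\,\|u\|_{\mathcal L^{q,\tilde h}}\,\|v\|_{\mathcal L^{\tilde q,\hat h}}.$$ -/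

import Mathlib

open MeasureTheory Filter Topology
open scoped ENNReal NNReal SchwartzMap FourierTransform

namespace FourierLorentz

/-- The decreasing rearrangement `f^*(t) = inf {τ : |{x : |f x| > τ}| ≤ t}` (with respect to
Lebesgue measure), as an extended nonnegative number. -/
noncomputable def rearrangement {d : ℕ} (f : EuclideanSpace ℝ (Fin d) → ℂ) (t : ℝ) : ℝ≥0∞ :=
  sInf {τ : ℝ≥0∞ | volume {x | τ < ‖f x‖ₑ} ≤ ENNReal.ofReal t}

/-- The Lorentz norm `‖f‖_{L^{p,r}}`: it is `(∫_0^∞ (t^{1/p} f^*(t))^r dt/t)^{1/r}` for `r < ∞`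
and `sup_{t > 0} t^{1/p} f^*(t)` for `r = ∞`. -/
noncomputable def lorentzNorm {d : ℕ} (p r : ℝ≥0∞) (f : EuclideanSpace ℝ (Fin d) → ℂ) : ℝ≥0∞ :=
  if r = ∞ then
    ⨆ t : ℝ, ⨆ _ : 0 < t, ENNReal.ofReal t ^ (p⁻¹).toReal * rearrangement f t
  else
    (∫⁻ t in Set.Ioi (0 : ℝ),
      (ENNReal.ofReal t ^ (p⁻¹).toReal * rearrangement f t) ^ r.toReal / ENNReal.ofReal t)
        ^ (r.toReal)⁻¹

/-- Membership in the Lorentz space `L^{p,r}(ℝ^d)`. -/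
def MemLorentz {d : ℕ} (p r : ℝ≥0∞) (f : EuclideanSpace ℝ (Fin d) → ℂ) : Prop :=
  AEStronglyMeasurable f volume ∧ lorentzNorm p r f < ∞

/-- The tempered distribution `T` is (integration against) the function `f`. -/
def Represents {d : ℕ} (f : EuclideanSpace ℝ (Fin d) → ℂ)
    (T : 𝓢'(EuclideanSpace ℝ (Fin d), ℂ)) : Prop :=
  AEStronglyMeasurable f volume ∧
    ∀ ψ : 𝓢(EuclideanSpace ℝ (Fin d), ℂ),
      Integrable (fun x => f x * ψ x) volume ∧ T ψ = ∫ x, f x * ψ x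

/-- Membership in the Fourier-Lorentz space `𝓛^{p,r} = 𝓕⁻¹(L^{p',r})`, `1/p + 1/p' = 1`:
the Fourier transform of the tempered distribution `u` is a function in `L^{p',r}`. -/
def MemFourierLorentz {d : ℕ} (p r : ℝ≥0∞) (u : 𝓢'(EuclideanSpace ℝ (Fin d), ℂ)) : Prop :=
  ∃ f : EuclideanSpace ℝ (Fin d) → ℂ, MemLorentz p.conjExponent r f ∧ Represents f (𝓕 u)

/-- The norm `‖u‖_{𝓛^{p,r}} = ‖𝓕 u‖_{L^{p',r}}`. A function representing `𝓕 u` is unique up to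
null sets, so the infimum is over functions which all have the same Lorentz norm
(and it is `∞` if `𝓕 u` is not a function). -/
noncomputable def fourierLorentzNorm {d : ℕ} (p r : ℝ≥0∞)
    (u : 𝓢'(EuclideanSpace ℝ (Fin d), ℂ)) : ℝ≥0∞ :=
  ⨅ f : EuclideanSpace ℝ (Fin d) → ℂ, ⨅ _ : Represents f (𝓕 u), lorentzNorm p.conjExponent r f

/-- The Schwartz function `y ↦ ε^{-d} φ ((x - y) / ε)`, for `ε > 0`
(see `approxKernel_apply`). -/
noncomputable def approxKernel {d : ℕ} (φ : 𝓢(EuclideanSpace ℝ (Fin d), ℂ)) (ε : ℝ)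
    (x : EuclideanSpace ℝ (Fin d)) : 𝓢(EuclideanSpace ℝ (Fin d), ℂ) :=
  if hε : 0 < ε then
    ((ε : ℂ) ^ d)⁻¹ •
      SchwartzMap.compSubConstCLM ℂ x
        (SchwartzMap.compCLMOfContinuousLinearEquiv ℂ
          (ContinuousLinearEquiv.smulLeft (R₁ := ℝ) (M₁ := EuclideanSpace ℝ (Fin d))
            (Units.mk0 (-ε⁻¹) (neg_ne_zero.mpr (inv_ne_zero hε.ne')))) φ)
  else 0

theorem approxKernel_apply {d : ℕ} (φ : 𝓢(EuclideanSpace ℝ (Fin d), ℂ)) {ε : ℝ} (hε : 0 < ε)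
    (x y : EuclideanSpace ℝ (Fin d)) :
    approxKernel φ ε x y = ((ε : ℂ) ^ d)⁻¹ * φ (ε⁻¹ • (x - y)) := by
  have h : (-ε⁻¹) • (y - x) = ε⁻¹ • (x - y) := by
    rw [neg_smul, ← smul_neg, neg_sub]
  simp [approxKernel, hε, ← h, Units.smul_def]

/-- The regularization `(u * φ_ε)(x)`, where `φ_ε(x) = ε^{-d} φ(x / ε)`. -/
noncomputable def mollify {d : ℕ} (φ : 𝓢(EuclideanSpace ℝ (Fin d), ℂ)) (ε : ℝ)
    (u : 𝓢'(EuclideanSpace ℝ (Fin d), ℂ)) (x : EuclideanSpace ℝ (Fin d)) : ℂ :=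
  u (approxKernel φ ε x)

/-- `w` is the product `u v` of the tempered distributions `u` and `v`: the pointwise products
`(u * φ_ε) (v * φ_ε)` of the regularizations, which are smooth functions, tend to `w` in the sense
of tempered distributions as `ε → 0+`, for every Schwartz function `φ` of integral one. -/
def IsProduct {d : ℕ} (u v w : 𝓢'(EuclideanSpace ℝ (Fin d), ℂ)) : Prop :=
  ∀ φ : 𝓢(EuclideanSpace ℝ (Fin d), ℂ), ∫ x, φ x = 1 →
    ∀ ψ : 𝓢(EuclideanSpace ℝ (Fin d), ℂ),
      Tendsto (fun ε : ℝ => ∫ x, mollify φ ε u x * mollify φ ε v x * ψ x) (𝓝[>] 0) (𝓝 (w ψ))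

/-- The product is unique when it exists. -/
theorem IsProduct.unique {d : ℕ} {u v w w' : 𝓢'(EuclideanSpace ℝ (Fin d), ℂ)}
    (hw : IsProduct u v w) (hw' : IsProduct u v w') : w = w' := by
  let b : ContDiffBump (0 : EuclideanSpace ℝ (Fin d)) := ⟨1, 2, one_pos, one_lt_two⟩
  let g : EuclideanSpace ℝ (Fin d) → ℂ := fun x => ((b.normed volume x : ℝ) : ℂ)
  have hg : ContDiff ℝ ((⊤ : ℕ∞) : WithTop ℕ∞) g := Complex.ofRealCLM.contDiff.comp b.contDiff_normed
  have hc : HasCompactSupport g :=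
    b.hasCompactSupport_normed.comp_left (g := fun t : ℝ => (t : ℂ)) Complex.ofReal_zero
  have hint : ∫ x, (hc.toSchwartzMap hg) x = 1 := by
    change ∫ x, ((b.normed volume x : ℝ) : ℂ) = 1
    rw [integral_complex_ofReal, b.integral_normed, Complex.ofReal_one]
  ext ψ
  exact tendsto_nhds_unique (hw _ hint ψ) (hw' _ hint ψ)

end FourierLorentz

/-! On the Fourier side the product becomes a convolution: if `f` and `g` represent the transforms
of `u` and `v`, then the transform of `uv` should be `f * g`. The claim is thus O'Neil's convolution
inequality in Lorentz spaces, with exponents `a = 1/q₁'`, `b = 1/q₂'`, `c = 1/r'`, for which `1/r =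
1/q₁ + 1/q₂` reads `a + b = c + 1`.

O'Neil's inequality starts from a pointwise bound (`decRearr_convolution_le`): `(F * G)^*(t)` is at
most `4 t⁻¹ ∫₀ᵗ F^* ∫₀ᵗ G^* + ∫ₜ^∞ F^* G^*`. It is obtained by cutting `F` and `G` at the heights
`F^*(t)` and `G^*(t)`. After multiplication by `t^c`, Hölder in `L^h(dt/t)` and the two Hardy
inequalities bound both terms. Each Hardy inequality expresses that an average of dilations is
bounded on `L^h(dt/t)`, because `dt/t` is dilation invariant. The conditions `a, b < 1` and `c > 0`
make the Hardy constants finite.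

For the existence of the product, the regularized pairing is an integral of `f(ξ) g(η)` against
`φ̂(εξ) φ̂(εη) (𝓕⁻ψ)(ξ + η)`. Since `φ̂(εξ)` is bounded and tends to `∫ φ = 1`, dominated
convergence gives the limit, provided `|f| * |g|` is integrable against Schwartz functions. O'Neil's
bound supplies this: `|f| * |g|` splits into an integrable and a bounded part. -/

namespace FourierLorentz

/-! ### Decreasing rearrangements and comparison of distribution functions. -/

section Rearrangement

variable {α : Type*} [MeasurableSpace α] {μ : Measure α}

/-- The decreasing rearrangement of an extended nonnegative function on a measure space. -/
noncomputable def decRearr (μ : Measure α) (F : α → ℝ≥0∞) (t : ℝ) : ℝ≥0∞ :=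
  sInf {τ : ℝ≥0∞ | μ {x | τ < F x} ≤ ENNReal.ofReal t}

/-- The infimum is attained: `{σ < F}` is the increasing union of the sets `{u n < F}` with `u n`
decreasing to `σ`, and continuity from below needs no finiteness or measurability. -/
theorem decRearr_le_iff {F : α → ℝ≥0∞} {t : ℝ} {σ : ℝ≥0∞} :
    decRearr μ F t ≤ σ ↔ μ {x | σ < F x} ≤ ENNReal.ofReal t := by
  refine ⟨fun h => ?_, fun h => sInf_le h⟩
  rcases eq_or_ne σ ∞ with rfl | hσ
  · simp
  obtain ⟨u, hu_anti, hu_gt, hu_lim⟩ := exists_seq_strictAnti_tendsto' (lt_top_iff_ne_top.2 hσ)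
  have hset : {x | σ < F x} = ⋃ n, {x | u n < F x} := by
    ext x
    simp only [Set.mem_ofPred_eq, Set.mem_iUnion]
    refine ⟨fun hx => (hu_lim.eventually (gt_mem_nhds hx)).exists, fun ⟨n, hn⟩ =>
      (hu_gt n).1.trans hn⟩
  have hmono : Monotone fun n => {x | u n < F x} := fun m n hmn x hx =>
    lt_of_le_of_lt (hu_anti.antitone hmn) hx
  rw [hset, hmono.measure_iUnion]
  refine iSup_le fun n => ?_
  obtain ⟨τ, hτ, hτu⟩ := sInf_lt_iff.1 (h.trans_lt (hu_gt n).1)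
  exact (measure_mono fun x (hx : u n < F x) => hτu.trans hx).trans hτ

theorem lt_decRearr_iff {F : α → ℝ≥0∞} {t : ℝ} {σ : ℝ≥0∞} :
    σ < decRearr μ F t ↔ ENNReal.ofReal t < μ {x | σ < F x} := by
  rw [← not_le, decRearr_le_iff, not_le]

theorem measure_decRearr_lt_le (F : α → ℝ≥0∞) (t : ℝ) :
    μ {x | decRearr μ F t < F x} ≤ ENNReal.ofReal t :=
  decRearr_le_iff.1 le_rfl

theorem decRearr_antitone (F : α → ℝ≥0∞) : Antitone (decRearr μ F) := fun _ _ hst =>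
  decRearr_le_iff.2 ((measure_decRearr_lt_le F _).trans (ENNReal.ofReal_le_ofReal hst))

theorem measurable_decRearr (F : α → ℝ≥0∞) : Measurable (decRearr μ F) :=
  (decRearr_antitone F).measurable

theorem decRearr_mono_ae {F G : α → ℝ≥0∞} (h : F ≤ᵐ[μ] G) (t : ℝ) :
    decRearr μ F t ≤ decRearr μ G t :=
  decRearr_le_iff.2 <| (measure_mono_ae (h.mono fun _ hx hlt => lt_of_lt_of_le hlt hx)).trans
    (measure_decRearr_lt_le G t)

theorem decRearr_congr_ae {F G : α → ℝ≥0∞} (h : F =ᵐ[μ] G) : decRearr μ F = decRearr μ G :=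
  funext fun t => le_antisymm (decRearr_mono_ae h.le t) (decRearr_mono_ae h.symm.le t)

theorem volume_setOf_pos_ofReal_lt (D : ℝ≥0∞) :
    volume {s : ℝ | 0 < s ∧ ENNReal.ofReal s < D} = D := by
  rcases eq_or_ne D ∞ with rfl | hD
  · have : {s : ℝ | 0 < s ∧ ENNReal.ofReal s < ∞} = Set.Ioi 0 := by ext; simp
    rw [this, Real.volume_Ioi]
  · have : {s : ℝ | 0 < s ∧ ENNReal.ofReal s < D} = Set.Ioo 0 D.toReal := by
      ext s
      simp only [Set.mem_ofPred_eq, Set.mem_Ioo, and_congr_right_iff]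
      intro hs
      rw [ENNReal.ofReal_lt_iff_lt_toReal hs.le hD]
    rw [this, Real.volume_Ioo, sub_zero, ENNReal.ofReal_toReal hD]

theorem measurableSet_setOf_ofReal_lt {β : Type*} [MeasurableSpace β] {A : β → ℝ≥0∞}
    (hA : Measurable A) : MeasurableSet {p : β × ℝ | ENNReal.ofReal p.2 < A p.1} :=
  measurableSet_lt (ENNReal.measurable_ofReal.comp measurable_snd) (hA.comp measurable_fst)

/-- The layer cake formula for a product of two functions. -/
theorem lintegral_mul_eq_lintegral_meas_lt [SFinite μ] {F G : α → ℝ≥0∞} (hF : Measurable F)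
    (hG : Measurable G) :
    ∫⁻ x, F x * G x ∂μ = ∫⁻ σ in Set.Ioi (0 : ℝ), ∫⁻ τ in Set.Ioi (0 : ℝ),
      μ {x | ENNReal.ofReal σ < F x ∧ ENNReal.ofReal τ < G x} := by
  have hlayer : ∀ D : ℝ≥0∞, ∫⁻ s in Set.Ioi (0 : ℝ),
      {s : ℝ | ENNReal.ofReal s < D}.indicator 1 s = D := by
    intro D
    have hm : MeasurableSet {s : ℝ | ENNReal.ofReal s < D} :=
      measurableSet_lt ENNReal.measurable_ofReal measurable_const
    rw [lintegral_indicator_one hm, Measure.restrict_apply hm, Set.inter_comm]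
    exact volume_setOf_pos_ofReal_lt D
  have hFm := measurableSet_setOf_ofReal_lt hF
  have hGm := measurableSet_setOf_ofReal_lt hG
  have h1 : ∀ x, F x * G x = ∫⁻ σ in Set.Ioi (0 : ℝ), ∫⁻ τ in Set.Ioi (0 : ℝ),
      {p : α × ℝ | ENNReal.ofReal p.2 < F p.1}.indicator (1 : α × ℝ → ℝ≥0∞) (x, σ) *
      {p : α × ℝ | ENNReal.ofReal p.2 < G p.1}.indicator (1 : α × ℝ → ℝ≥0∞) (x, τ) := by
    intro x
    have e1 : ∀ σ, ∫⁻ τ in Set.Ioi (0 : ℝ),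
        {p : α × ℝ | ENNReal.ofReal p.2 < F p.1}.indicator (1 : α × ℝ → ℝ≥0∞) (x, σ) *
        {p : α × ℝ | ENNReal.ofReal p.2 < G p.1}.indicator (1 : α × ℝ → ℝ≥0∞) (x, τ) =
        {s : ℝ | ENNReal.ofReal s < F x}.indicator 1 σ * G x := by
      intro σ
      have hm : Measurable fun τ : ℝ =>
          {p : α × ℝ | ENNReal.ofReal p.2 < G p.1}.indicator (1 : α × ℝ → ℝ≥0∞) (x, τ) :=
        (measurable_one.indicator hGm).comp measurable_prodMk_left
      rw [lintegral_const_mul _ hm]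
      congr 1
      exact hlayer (G x)
    simp_rw [e1]
    rw [lintegral_mul_const _ (measurable_one.indicator
      (measurableSet_lt ENNReal.measurable_ofReal measurable_const)), hlayer]
  have hmeas : Measurable fun q : (α × ℝ) × ℝ =>
      {p : α × ℝ | ENNReal.ofReal p.2 < F p.1}.indicator (1 : α × ℝ → ℝ≥0∞) (q.1.1, q.1.2) *
      {p : α × ℝ | ENNReal.ofReal p.2 < G p.1}.indicator (1 : α × ℝ → ℝ≥0∞) (q.1.1, q.2) :=
    ((measurable_one.indicator hFm).comp (by fun_prop)).mul
      ((measurable_one.indicator hGm).comp (by fun_prop))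
  simp_rw [h1]
  rw [lintegral_lintegral_swap]
  · refine lintegral_congr fun σ => ?_
    rw [lintegral_lintegral_swap]
    · refine lintegral_congr fun τ => ?_
      rw [← lintegral_indicator_one]
      · refine lintegral_congr fun x => ?_
        by_cases h1 : ENNReal.ofReal σ < F x <;> by_cases h2 : ENNReal.ofReal τ < G x <;>
          simp [Set.indicator, h1, h2]
      · exact (measurableSet_lt measurable_const hF).inter (measurableSet_lt measurable_const hG)
    · exact (hmeas.comp (by fun_prop : Measurable fun q : α × ℝ => ((q.1, σ), q.2))).aemeasurable
  · exact (Measurable.lintegral_prod_right' hmeas).aemeasurable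

/-- Comparison of the integrals of two products through their joint distribution functions. -/
theorem lintegral_mul_le_of_meas_lt {β : Type*} [MeasurableSpace β] {ν : Measure β} [SFinite μ]
    [SFinite ν] {F G : α → ℝ≥0∞} {A B : β → ℝ≥0∞} (hF : Measurable F) (hG : Measurable G)
    (hA : Measurable A) (hB : Measurable B)
    (h : ∀ σ τ : ℝ≥0∞, μ {x | σ < F x ∧ τ < G x} ≤ ν {x | σ < A x ∧ τ < B x}) :
    ∫⁻ x, F x * G x ∂μ ≤ ∫⁻ x, A x * B x ∂ν := by
  rw [lintegral_mul_eq_lintegral_meas_lt hF hG, lintegral_mul_eq_lintegral_meas_lt hA hB]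
  exact lintegral_mono fun σ => lintegral_mono fun τ => h _ _

/-- The part of `F` above `F^*(t)` lives on a set of measure at most `t`. Its level sets therefore
have measure at most `min(μ{σ < F}, t)`, which is exactly the length of `{s ∈ (0, t) : σ < F^*(s)}`.
-/
theorem setLIntegral_gt_decRearr_le [SFinite μ] {F : α → ℝ≥0∞} (hF : Measurable F) (t : ℝ) :
    ∫⁻ x, {x | decRearr μ F t < F x}.indicator F x ∂μ ≤
      ∫⁻ s in Set.Ioo 0 t, decRearr μ F s := by
  have hm : MeasurableSet {x | decRearr μ F t < F x} := measurableSet_lt measurable_const hF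
  have := lintegral_mul_le_of_meas_lt (μ := μ) (ν := volume.restrict (Set.Ioo 0 t))
    (F := {x | decRearr μ F t < F x}.indicator F) (G := 1) (A := decRearr μ F) (B := 1)
    (hF.indicator hm) measurable_one (measurable_decRearr F) measurable_one ?_
  · simpa using this
  · intro σ τ
    by_cases hτ : τ < 1
    swap
    · simp [hτ]
    simp only [Pi.one_apply, hτ, and_true]
    have hm2 : MeasurableSet {s | σ < decRearr μ F s} :=
      measurableSet_lt measurable_const (measurable_decRearr F)
    have hset : {s | σ < decRearr μ F s} ∩ Set.Ioo 0 t =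
        {s : ℝ | 0 < s ∧ ENNReal.ofReal s < min (μ {x | σ < F x}) (ENNReal.ofReal t)} := by
      ext s
      simp only [Set.mem_inter_iff, Set.mem_ofPred_eq, Set.mem_Ioo, lt_decRearr_iff, lt_min_iff]
      constructor
      · rintro ⟨h1, h2, h3⟩
        exact ⟨h2, h1, (ENNReal.ofReal_lt_ofReal_iff (h2.trans h3)).2 h3⟩
      · rintro ⟨h1, h2, h3⟩
        exact ⟨h2, h1, (ENNReal.ofReal_lt_ofReal_iff'.1 h3).1⟩
    rw [Measure.restrict_apply hm2, hset, volume_setOf_pos_ofReal_lt]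
    refine le_min (measure_mono fun x hx => ?_) ((measure_mono fun x hx => ?_).trans
      (measure_decRearr_lt_le F t))
    · have hx' : σ < {x | decRearr μ F t < F x}.indicator F x := hx
      exact hx'.trans_le (Set.indicator_le_self' (fun _ _ => zero_le) x)
    · have hx' : σ < {x | decRearr μ F t < F x}.indicator F x := hx
      exact Set.mem_of_indicator_ne_zero (ne_bot_of_gt hx')

/-- The Hardy-Littlewood inequality for functions truncated at height `F^*(t)`, `G^*(t)`. -/
theorem lintegral_truncation_mul_le [SFinite μ] {F G : α → ℝ≥0∞} (hF : Measurable F)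
    (hG : Measurable G) {e : α → α} (he : MeasurePreserving e μ μ) {t : ℝ} (ht : 0 < t) :
    ∫⁻ x, {x | F x ≤ decRearr μ F t}.indicator F x *
        {x | G x ≤ decRearr μ G t}.indicator G (e x) ∂μ ≤
      ENNReal.ofReal t * (decRearr μ F t * decRearr μ G t) +
        ∫⁻ s in Set.Ioi t, decRearr μ F s * decRearr μ G s := by
  have hmF : MeasurableSet {x | F x ≤ decRearr μ F t} := measurableSet_le hF measurable_const
  have hmG : MeasurableSet {x | G x ≤ decRearr μ G t} := measurableSet_le hG measurable_const
  have hA : Measurable fun s => min (decRearr μ F s) (decRearr μ F t) :=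
    (measurable_decRearr F).min measurable_const
  have hB : Measurable fun s => min (decRearr μ G s) (decRearr μ G t) :=
    (measurable_decRearr G).min measurable_const
  have hlt : ∀ {H : α → ℝ≥0∞} {σ : ℝ≥0∞} {x : α},
      σ < {x | H x ≤ decRearr μ H t}.indicator H x → σ < H x ∧ σ < decRearr μ H t := by
    intro H σ x hx
    have hmem : x ∈ {x | H x ≤ decRearr μ H t} := Set.mem_of_indicator_ne_zero (ne_bot_of_gt hx)
    rw [Set.indicator_of_mem hmem] at hx
    exact ⟨hx, hx.trans_le hmem⟩
  calc _ ≤ ∫⁻ s in Set.Ioi (0 : ℝ), min (decRearr μ F s) (decRearr μ F t) *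
        min (decRearr μ G s) (decRearr μ G t) := by
        refine lintegral_mul_le_of_meas_lt (hF.indicator hmF)
          ((hG.indicator hmG).comp he.measurable) hA hB fun σ τ => ?_
        -- Levels above the truncation heights contribute nothing. Below them, an intersection of
        -- two level sets has at most the smaller of their measures, with equality for the
        -- rearrangements, whose level sets are nested initial intervals.
        by_cases hσ : σ < decRearr μ F t
        swap
        · rw [Set.eq_empty_of_forall_notMem (s := {x | _ ∧ _}) fun x hx => hσ (hlt hx.1).2]
          simp
        by_cases hτ : τ < decRearr μ G t
        swap
        · rw [Set.eq_empty_of_forall_notMem (s := {x | _ ∧ _}) fun x hx => hτ (hlt hx.2).2]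
          simp
        have hm : MeasurableSet {s | σ < min (decRearr μ F s) (decRearr μ F t) ∧
            τ < min (decRearr μ G s) (decRearr μ G t)} :=
          (measurableSet_lt measurable_const hA).inter (measurableSet_lt measurable_const hB)
        rw [Measure.restrict_apply hm]
        have hset : {s | σ < min (decRearr μ F s) (decRearr μ F t) ∧
              τ < min (decRearr μ G s) (decRearr μ G t)} ∩ Set.Ioi 0 =
            {s : ℝ | 0 < s ∧ ENNReal.ofReal s < min (μ {x | σ < F x}) (μ {x | τ < G x})} := by
          ext s
          simp only [Set.mem_inter_iff, Set.mem_ofPred_eq, Set.mem_Ioi, lt_min_iff, hσ, hτ, and_true]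
          rw [lt_decRearr_iff, lt_decRearr_iff]
          tauto
        refine le_trans ?_ (le_of_eq (congrArg volume hset.symm))
        rw [volume_setOf_pos_ofReal_lt]
        refine le_min (measure_mono fun x hx => (hlt hx.1).1) ?_
        rw [← he.measure_preimage (measurableSet_lt measurable_const hG).nullMeasurableSet]
        exact measure_mono fun x hx => (hlt hx.2).1
    _ = (∫⁻ s in Set.Ioc 0 t, min (decRearr μ F s) (decRearr μ F t) *
          min (decRearr μ G s) (decRearr μ G t)) +
        ∫⁻ s in Set.Ioi t, min (decRearr μ F s) (decRearr μ F t) *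
          min (decRearr μ G s) (decRearr μ G t) := by
        rw [← lintegral_union measurableSet_Ioi, Set.Ioc_union_Ioi_eq_Ioi ht.le]
        exact Set.disjoint_left.2 fun s hs hs' => not_lt.2 hs.2 hs'
    _ ≤ _ := by
        gcongr
        · calc _ ≤ ∫⁻ _ in Set.Ioc 0 t, decRearr μ F t * decRearr μ G t :=
              lintegral_mono fun s => mul_le_mul' (min_le_right _ _) (min_le_right _ _)
            _ = _ := by simp [mul_comm]
        · exact min_le_left _ _
        · exact min_le_left _ _

/-- By monotonicity `F^*(t)` is at most the mean of `F^*` over `(0, t)`. -/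
theorem ofReal_mul_decRearr_le (F : α → ℝ≥0∞) (t : ℝ) :
    ENNReal.ofReal t * decRearr μ F t ≤ ∫⁻ s in Set.Ioo 0 t, decRearr μ F s := by
  calc _ = ∫⁻ _ in Set.Ioo 0 t, decRearr μ F t := by simp [mul_comm]
    _ ≤ _ := setLIntegral_mono (measurable_decRearr F) fun s hs => decRearr_antitone F hs.2.le

end Rearrangement

/-! ### O'Neil's pointwise estimate. -/

section Convolution

variable {E : Type*} [MeasurableSpace E] [AddCommGroup E] [MeasurableAdd₂ E] [MeasurableNeg E]
  {μ : Measure E} [μ.IsAddLeftInvariant]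

theorem measurePreserving_const_sub [μ.IsNegInvariant] (x : E) :
    MeasurePreserving (fun y => x - y) μ μ := by
  have := (measurePreserving_add_left μ x).comp (Measure.measurePreserving_neg μ)
  simpa [Function.comp_def, sub_eq_add_neg] using this

theorem lintegral_convolution [SFinite μ] {F G : E → ℝ≥0∞} (hF : Measurable F) (hG : Measurable G) :
    ∫⁻ x, ∫⁻ y, F y * G (x - y) ∂μ ∂μ = (∫⁻ x, F x ∂μ) * ∫⁻ x, G x ∂μ := by
  rw [lintegral_lintegral_swap]
  · rw [← lintegral_mul_const _ hF]
    refine lintegral_congr fun y => ?_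
    have hm : Measurable fun x => G (x - y) := hG.comp (measurable_id.sub_const y)
    rw [lintegral_const_mul _ hm, lintegral_sub_right_eq_self G y]
  · exact ((hF.comp measurable_snd).mul (hG.comp (measurable_fst.sub measurable_snd))).aemeasurable

/-- O'Neil's pointwise estimate for the rearrangement of a convolution. -/
theorem decRearr_convolution_le [SFinite μ] [μ.IsNegInvariant] {F G : E → ℝ≥0∞}
    (hF : Measurable F) (hG : Measurable G) {t : ℝ} (ht : 0 < t) :
    decRearr μ (fun x => ∫⁻ y, F y * G (x - y) ∂μ) t ≤
      4 * ((ENNReal.ofReal t)⁻¹ * ((∫⁻ s in Set.Ioo 0 t, decRearr μ F s) *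
        ∫⁻ s in Set.Ioo 0 t, decRearr μ G s)) +
      ∫⁻ s in Set.Ioi t, decRearr μ F s * decRearr μ G s := by
  set I := ∫⁻ s in Set.Ioo 0 t, decRearr μ F s
  set J := ∫⁻ s in Set.Ioo 0 t, decRearr μ G s
  set a := decRearr μ F t with ha
  set b := decRearr μ G t with hb
  set T := ENNReal.ofReal t
  have hT0 : T ≠ 0 := by simpa [T] using ht
  have hTt : T ≠ ∞ := ENNReal.ofReal_ne_top
  have hTc : ∀ z, T⁻¹ * (T * z) = z := fun z => by
    rw [← mul_assoc, ENNReal.inv_mul_cancel hT0 hTt, one_mul]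
  have haI : a ≤ T⁻¹ * I := by
    rw [← hTc a]
    gcongr
    exact ofReal_mul_decRearr_le F t
  have hbJ : b ≤ T⁻¹ * J := by
    rw [← hTc b]
    gcongr
    exact ofReal_mul_decRearr_le G t
  -- The letters `g` and `l` mark the parts greater than, and at most, the truncation height. Of the
  -- four convolutions, the three containing a bounded factor are estimated uniformly in `x`. Only
  -- `Fg * Gg` needs an exceptional set.
  set Fg := {x | a < F x}.indicator F
  set Fl := {x | F x ≤ a}.indicator F
  set Gg := {x | b < G x}.indicator G
  set Gl := {x | G x ≤ b}.indicator G
  have hFg : Measurable Fg := hF.indicator (measurableSet_lt measurable_const hF)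
  have hFl : Measurable Fl := hF.indicator (measurableSet_le hF measurable_const)
  have hGg : Measurable Gg := hG.indicator (measurableSet_lt measurable_const hG)
  have hGl : Measurable Gl := hG.indicator (measurableSet_le hG measurable_const)
  have hFs : ∀ x, F x = Fg x + Fl x := by
    intro x
    by_cases h : F x ≤ a
    · simp [Fg, Fl, h, not_lt.2 h]
    · simp [Fg, Fl, h, not_le.1 h]
  have hGs : ∀ x, G x = Gg x + Gl x := by
    intro x
    by_cases h : G x ≤ b
    · simp [Gg, Gl, h, not_lt.2 h]
    · simp [Gg, Gl, h, not_le.1 h]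
  have hFl_le : ∀ x, Fl x ≤ a := by
    intro x
    by_cases h : F x ≤ a <;> simp [Fl, h]
  have hGl_le : ∀ x, Gl x ≤ b := by
    intro x
    by_cases h : G x ≤ b <;> simp [Gl, h]
  have hFgI : ∫⁻ x, Fg x ∂μ ≤ I := setLIntegral_gt_decRearr_le hF t
  have hGgJ : ∫⁻ x, Gg x ∂μ ≤ J := setLIntegral_gt_decRearr_le hG t
  have hsubm : ∀ {K : E → ℝ≥0∞}, Measurable K → ∀ x, Measurable fun y => K (x - y) :=
    fun hK x => hK.comp (measurable_id.const_sub x)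
  have h2 : ∀ x, ∫⁻ y, Fg y * Gl (x - y) ∂μ ≤ T⁻¹ * (I * J) := by
    intro x
    calc _ ≤ ∫⁻ y, Fg y * b ∂μ := lintegral_mono fun y => by gcongr; exact hGl_le _
      _ = (∫⁻ y, Fg y ∂μ) * b := lintegral_mul_const _ hFg
      _ ≤ I * (T⁻¹ * J) := by gcongr
      _ = _ := by ring
  have h3 : ∀ x, ∫⁻ y, Fl y * Gg (x - y) ∂μ ≤ T⁻¹ * (I * J) := by
    intro x
    calc _ ≤ ∫⁻ y, a * Gg (x - y) ∂μ := lintegral_mono fun y => by gcongr; exact hFl_le _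
      _ = a * ∫⁻ y, Gg y ∂μ := by
        rw [lintegral_const_mul _ (hsubm hGg x), lintegral_sub_left_eq_self Gg x]
      _ ≤ (T⁻¹ * I) * J := by gcongr
      _ = _ := by ring
  set R := ∫⁻ s in Set.Ioi t, decRearr μ F s * decRearr μ G s
  have h4 : ∀ x, ∫⁻ y, Fl y * Gl (x - y) ∂μ ≤ T⁻¹ * (I * J) + R := by
    intro x
    refine (lintegral_truncation_mul_le hF hG (measurePreserving_const_sub x) ht).trans ?_
    refine add_le_add_left ?_ R
    calc T * (a * b) ≤ T * ((T⁻¹ * I) * (T⁻¹ * J)) := by gcongr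
      _ = (T * T⁻¹) * (T⁻¹ * (I * J)) := by ring
      _ = _ := by rw [ENNReal.mul_inv_cancel hT0 hTt, one_mul]
  have hsplit : ∀ x, ∫⁻ y, F y * G (x - y) ∂μ ≤
      ∫⁻ y, Fg y * Gg (x - y) ∂μ + (3 * (T⁻¹ * (I * J)) + R) := by
    intro x
    calc ∫⁻ y, F y * G (x - y) ∂μ
        = ∫⁻ y, (Fg y * Gg (x - y) + (Fg y * Gl (x - y) + (Fl y * Gg (x - y) +
            Fl y * Gl (x - y)))) ∂μ := lintegral_congr fun y => by rw [hFs y, hGs (x - y)]; ring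
      _ = ∫⁻ y, Fg y * Gg (x - y) ∂μ + (∫⁻ y, Fg y * Gl (x - y) ∂μ +
            (∫⁻ y, Fl y * Gg (x - y) ∂μ + ∫⁻ y, Fl y * Gl (x - y) ∂μ)) := by
          have m1 : Measurable fun y => Fg y * Gg (x - y) := hFg.mul (hsubm hGg x)
          have m2 : Measurable fun y => Fg y * Gl (x - y) := hFg.mul (hsubm hGl x)
          have m3 : Measurable fun y => Fl y * Gg (x - y) := hFl.mul (hsubm hGg x)
          rw [lintegral_add_left m1, lintegral_add_left m2, lintegral_add_left m3]
      _ ≤ ∫⁻ y, Fg y * Gg (x - y) ∂μ + (T⁻¹ * (I * J) + (T⁻¹ * (I * J) +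
            (T⁻¹ * (I * J) + R))) := by
          gcongr
          exacts [h2 x, h3 x, h4 x]
      _ = _ := by ring
  -- Chebyshev: `Fg * Gg` has integral at most `I * J = T * L`, so it exceeds `L` on a set of
  -- measure at most `T`. Division by `L` forces the cases `L = 0` and `L = ∞` to be treated apart.
  have hconv : μ {x | T⁻¹ * (I * J) < ∫⁻ y, Fg y * Gg (x - y) ∂μ} ≤ T := by
    set L := T⁻¹ * (I * J) with hL
    have hint : ∫⁻ x, ∫⁻ y, Fg y * Gg (x - y) ∂μ ∂μ ≤ T * L := by
      rw [lintegral_convolution hFg hGg, hL, ← mul_assoc, ENNReal.mul_inv_cancel hT0 hTt, one_mul]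
      gcongr
    have hmeas : Measurable fun x => ∫⁻ y, Fg y * Gg (x - y) ∂μ :=
      Measurable.lintegral_prod_right'
        (f := fun q : E × E => Fg q.2 * Gg (q.1 - q.2))
        ((hFg.comp measurable_snd).mul (hGg.comp (measurable_fst.sub measurable_snd)))
    rcases eq_or_ne L ∞ with hLt | hLt
    · simp [hLt]
    rcases eq_or_ne L 0 with hL0 | hL0
    · rw [hL0, mul_zero, nonpos_iff_eq_zero, lintegral_eq_zero_iff hmeas] at hint
      rw [hL0]
      refine le_of_eq_of_le ?_ zero_le
      have h0 := ae_iff.1 hint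
      simpa [pos_iff_ne_zero] using h0
    · have := (mul_meas_ge_le_lintegral hmeas L).trans hint
      rw [mul_comm T] at this
      exact (measure_mono fun x (hx : L < _) => hx.le).trans
        ((ENNReal.mul_le_mul_iff_right hL0 hLt).1 this)
  rw [decRearr_le_iff]
  refine (measure_mono fun x hx => ?_).trans hconv
  simp only [Set.mem_ofPred_eq] at hx ⊢
  by_contra! hcon
  refine absurd hx (not_lt.2 ((hsplit x).trans ?_))
  calc _ ≤ T⁻¹ * (I * J) + (3 * (T⁻¹ * (I * J)) + R) := by gcongr
    _ = _ := by ring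

end Convolution

/-! ### The spaces `L^h(dt/t)`: Minkowski, Hölder and dilations. -/

section MulNorm

/-- The `L^h` norm on `(0, ∞)` with respect to the multiplicative Haar measure `dt / t`. -/
noncomputable def mulNorm (h : ℝ≥0∞) (G : ℝ → ℝ≥0∞) : ℝ≥0∞ :=
  if h = ∞ then ⨆ t : ℝ, ⨆ _ : 0 < t, G t
  else (∫⁻ t in Set.Ioi (0 : ℝ), (G t) ^ h.toReal / ENNReal.ofReal t) ^ (h.toReal)⁻¹

theorem lorentzNorm_eq_mulNorm {d : ℕ} (p h : ℝ≥0∞) (f : EuclideanSpace ℝ (Fin d) → ℂ) :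
    lorentzNorm p h f = mulNorm h fun t =>
      ENNReal.ofReal t ^ (p⁻¹).toReal * decRearr volume (fun x => ‖f x‖ₑ) t := rfl

theorem mulNorm_top (G : ℝ → ℝ≥0∞) : mulNorm ∞ G = ⨆ t : ℝ, ⨆ _ : 0 < t, G t := if_pos rfl

/-- The measure `dt / t` on `(0, ∞)`. -/
noncomputable def haarIoi : Measure ℝ :=
  (volume.restrict (Set.Ioi (0 : ℝ))).withDensity fun t => (ENNReal.ofReal t)⁻¹

theorem lintegral_haarIoi {G : ℝ → ℝ≥0∞} (hG : Measurable G) :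
    ∫⁻ t, G t ∂haarIoi = ∫⁻ t in Set.Ioi (0 : ℝ), G t / ENNReal.ofReal t := by
  have hm : Measurable fun t : ℝ => (ENNReal.ofReal t)⁻¹ := ENNReal.measurable_ofReal.inv
  rw [haarIoi, lintegral_withDensity_eq_lintegral_mul _ hm hG]
  exact lintegral_congr fun t => by rw [Pi.mul_apply, mul_comm]; rfl

theorem mulNorm_of_ne_top {h : ℝ≥0∞} (hh : h ≠ ∞) {G : ℝ → ℝ≥0∞} (hG : Measurable G) :
    mulNorm h G = (∫⁻ t, (G t) ^ h.toReal ∂haarIoi) ^ (1 / h.toReal) := by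
  rw [mulNorm, if_neg hh, lintegral_haarIoi (hG.pow_const _), one_div]

theorem mulNorm_mono {h : ℝ≥0∞} {G G' : ℝ → ℝ≥0∞} (hle : ∀ t, 0 < t → G t ≤ G' t) :
    mulNorm h G ≤ mulNorm h G' := by
  unfold mulNorm
  split_ifs
  · exact iSup₂_mono hle
  · gcongr ?_ ^ _
    refine setLIntegral_mono' measurableSet_Ioi fun t ht => ?_
    gcongr
    exact hle t ht

theorem one_le_toReal {h : ℝ≥0∞} (hh : 1 ≤ h) (hh' : h ≠ ∞) : 1 ≤ h.toReal := by
  simpa using (ENNReal.toReal_le_toReal ENNReal.one_ne_top hh').2 hh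

theorem mulNorm_add_le {h : ℝ≥0∞} (hh : 1 ≤ h) {G G' : ℝ → ℝ≥0∞} (hG : Measurable G)
    (hG' : Measurable G') :
    mulNorm h (fun t => G t + G' t) ≤ mulNorm h G + mulNorm h G' := by
  rcases eq_or_ne h ∞ with rfl | hht
  · simp only [mulNorm_top]
    exact iSup₂_le fun t ht => add_le_add (le_iSup₂_of_le t ht le_rfl) (le_iSup₂_of_le t ht le_rfl)
  · have hm : Measurable fun t => G t + G' t := hG.add hG'
    rw [mulNorm_of_ne_top hht hG, mulNorm_of_ne_top hht hG', mulNorm_of_ne_top hht hm]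
    exact ENNReal.lintegral_Lp_add_le hG.aemeasurable hG'.aemeasurable (one_le_toReal hh hht)

theorem mulNorm_const_mul_le {h : ℝ≥0∞} (hh : 1 ≤ h) {G : ℝ → ℝ≥0∞} (hG : Measurable G)
    (c : ℝ≥0∞) : mulNorm h (fun t => c * G t) ≤ c * mulNorm h G := by
  rcases eq_or_ne h ∞ with rfl | hht
  · simp only [mulNorm_top]
    exact iSup₂_le fun t ht => by gcongr; exact le_iSup₂_of_le t ht le_rfl
  · have h1 := one_le_toReal hh hht
    rw [mulNorm_of_ne_top hht hG, mulNorm_of_ne_top hht (hG.const_mul c)]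
    simp_rw [ENNReal.mul_rpow_of_nonneg _ _ (zero_le_one.trans h1)]
    rw [lintegral_const_mul _ (hG.pow_const _), ENNReal.mul_rpow_of_nonneg _ _ (by positivity),
      ← ENNReal.rpow_mul, mul_one_div_cancel (by positivity), ENNReal.rpow_one]

theorem mulNorm_mul_le {h h₁ h₂ : ℝ≥0∞} (hh : 1 ≤ h) (hh₁ : 1 ≤ h₁) (hh₂ : 1 ≤ h₂)
    (hhh : h⁻¹ = h₁⁻¹ + h₂⁻¹) {G G' : ℝ → ℝ≥0∞} (hG : Measurable G) (hG' : Measurable G') :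
    mulNorm h (fun t => G t * G' t) ≤ mulNorm h₁ G * mulNorm h₂ G' := by
  have hsup : ∀ {K : ℝ → ℝ≥0∞} {t : ℝ}, 0 < t → K t ≤ mulNorm ∞ K := fun {K t} ht => by
    rw [mulNorm_top]
    exact le_iSup₂_of_le t ht le_rfl
  rcases eq_or_ne h₁ ∞ with rfl | h₁t
  · obtain rfl : h = h₂ := by simpa using hhh
    exact (mulNorm_mono fun t ht => mul_le_mul' (hsup ht) le_rfl).trans
      (mulNorm_const_mul_le hh hG' _)
  rcases eq_or_ne h₂ ∞ with rfl | h₂t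
  · obtain rfl : h = h₁ := by simpa using hhh
    rw [mul_comm]
    refine (mulNorm_mono fun t ht => ?_).trans (mulNorm_const_mul_le hh hG _)
    rw [mul_comm]
    exact mul_le_mul' (hsup ht) le_rfl
  have h₁0 : h₁ ≠ 0 := (zero_lt_one.trans_le hh₁).ne'
  have h₂0 : h₂ ≠ 0 := (zero_lt_one.trans_le hh₂).ne'
  have ht : h ≠ ∞ := by
    rintro rfl
    exact h₁t (ENNReal.inv_eq_zero.1 (add_eq_zero.1 (hhh.symm.trans ENNReal.inv_top)).1)
  have h1 := one_le_toReal hh ht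
  have h2 := one_le_toReal hh₁ h₁t
  have h3 := one_le_toReal hh₂ h₂t
  have hreal : 1 / h.toReal = 1 / h₁.toReal + 1 / h₂.toReal := by
    simp_rw [one_div, ← ENNReal.toReal_inv]
    rw [hhh, ENNReal.toReal_add (by simpa) (by simpa)]
  have hm : Measurable fun t => G t * G' t := hG.mul hG'
  rw [mulNorm_of_ne_top ht hm, mulNorm_of_ne_top h₁t hG, mulNorm_of_ne_top h₂t hG']
  refine ENNReal.lintegral_Lp_mul_le_Lq_mul_Lr (by positivity) ?_ hreal _ hG.aemeasurable
    hG'.aemeasurable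
  rw [← one_div_lt_one_div (by positivity) (by positivity), hreal]
  have : 0 < 1 / h₂.toReal := by positivity
  linarith

/-- If `G` were infinite on all of `(0, ∞)`, the integrand would be infinite on a set of positive
measure. -/
theorem exists_lt_top_of_mulNorm_lt_top {h : ℝ≥0∞} (hh : 1 ≤ h) {G : ℝ → ℝ≥0∞}
    (hG : Measurable G) (hfin : mulNorm h G < ∞) : ∃ t, 0 < t ∧ G t < ∞ := by
  rcases eq_or_ne h ∞ with rfl | hht
  · rw [mulNorm_top] at hfin
    exact ⟨1, one_pos, (le_iSup₂_of_le (f := fun t (_ : 0 < t) => G t) 1 one_pos le_rfl).trans_lt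
      hfin⟩
  · have h1 := one_le_toReal hh hht
    have hpos : 0 < h.toReal := by positivity
    rw [mulNorm, if_neg hht, ENNReal.rpow_lt_top_iff_of_pos (inv_pos.2 hpos)] at hfin
    have hae := ae_lt_top ((hG.pow_const _).div ENNReal.measurable_ofReal) hfin.ne
    rw [ae_restrict_iff' measurableSet_Ioi] at hae
    by_contra! hcon
    have hnull : ∀ᵐ t : ℝ, t ∉ Set.Ioi (0 : ℝ) := hae.mono fun t ht h0 => by
      have := ht h0
      simp [top_le_iff.1 (hcon t h0), hpos, ENNReal.top_div] at this
    have hzero := measure_eq_zero_iff_ae_notMem.2 hnull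
    simp at hzero

/-- Change of variables `s = t s'` in an integral over a subset of the line. -/
theorem setLIntegral_eq_mul_setLIntegral_comp_mul {φ : ℝ → ℝ≥0∞} (hφ : Measurable φ) {S : Set ℝ}
    (hS : MeasurableSet S) {t : ℝ} (ht : 0 < t) :
    ∫⁻ s in S, φ s = ENNReal.ofReal t * ∫⁻ s in (t * ·) ⁻¹' S, φ (t * s) := by
  conv_lhs => rw [← Real.smul_map_volume_mul_left ht.ne']
  rw [Measure.restrict_smul, lintegral_smul_measure, abs_of_pos ht,
    setLIntegral_map hS hφ (measurable_const_mul t), smul_eq_mul]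

theorem lintegral_haarIoi_comp_mul {G : ℝ → ℝ≥0∞} (hG : Measurable G) {s : ℝ} (hs : 0 < s) :
    ∫⁻ t, G (t * s) ∂haarIoi = ∫⁻ t, G t ∂haarIoi := by
  have hm : Measurable fun t => G (t * s) := hG.comp (measurable_mul_const s)
  have hm' : Measurable fun t => G t / ENNReal.ofReal t := hG.div ENNReal.measurable_ofReal
  have hms : Measurable fun t => G (s * t) / ENNReal.ofReal (s * t) :=
    hm'.comp (measurable_const_mul s)
  rw [lintegral_haarIoi hG, lintegral_haarIoi hm,
    setLIntegral_eq_mul_setLIntegral_comp_mul hm' measurableSet_Ioi hs,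
    ← lintegral_const_mul _ hms]
  · have : (s * ·) ⁻¹' Set.Ioi 0 = Set.Ioi (0 : ℝ) := by ext; simp [hs]
    rw [this]
    refine setLIntegral_congr_fun measurableSet_Ioi fun t ht => ?_
    rw [ENNReal.ofReal_mul hs.le, mul_comm t s, ← mul_div_assoc,
      ENNReal.mul_div_mul_left _ _ (by simpa using hs) ENNReal.ofReal_ne_top]

/-- Jensen's inequality for a measure that is not normalized, obtained from Hölder against the
constant `1`. It is applied to the measure `k(s) ds` below. -/
theorem lintegral_rpow_le_measure_univ_rpow_mul {α : Type*} [MeasurableSpace α] (m : Measure α)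
    {G : α → ℝ≥0∞} (hG : Measurable G) {q : ℝ} (hq : 1 ≤ q) :
    (∫⁻ x, G x ∂m) ^ q ≤ m Set.univ ^ (q - 1) * ∫⁻ x, G x ^ q ∂m := by
  have hq0 : 0 < q := by positivity
  rcases hq.eq_or_lt with rfl | hq1
  · simp
  have hc := Real.HolderConjugate.conjExponent hq1
  have := ENNReal.lintegral_mul_le_Lp_mul_Lq m hc hG.aemeasurable
    (measurable_one (α := ℝ≥0∞)).aemeasurable
  simp only [mul_one, Pi.one_apply, ENNReal.one_rpow, lintegral_one] at this
  calc _ ≤ _ := ENNReal.rpow_le_rpow this hq0.le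
    _ = _ := by
      rw [ENNReal.mul_rpow_of_nonneg _ _ hq0.le, ← ENNReal.rpow_mul, ← ENNReal.rpow_mul,
        one_div_mul_cancel hq0.ne', ENNReal.rpow_one, mul_comm]
      congr 2
      rw [Real.conjExponent]
      field_simp

/-- Averages of dilations are bounded on `L^h(dt / t)`. -/
theorem mulNorm_lintegral_dilation_le {h : ℝ≥0∞} (hh : 1 ≤ h) {k G : ℝ → ℝ≥0∞}
    (hk : Measurable k) (hG : Measurable G) :
    mulNorm h (fun t => ∫⁻ s in Set.Ioi (0 : ℝ), k s * G (t * s)) ≤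
      (∫⁻ s in Set.Ioi (0 : ℝ), k s) * mulNorm h G := by
  have hmeas : Measurable fun p : ℝ × ℝ => k p.2 * G (p.1 * p.2) :=
    (hk.comp measurable_snd).mul (hG.comp (measurable_fst.mul measurable_snd))
  have hsec : ∀ t : ℝ, Measurable fun s => G (t * s) := fun t => hG.comp (measurable_const_mul t)
  rcases eq_or_ne h ∞ with rfl | hht
  · simp only [mulNorm_top]
    refine iSup₂_le fun t ht => ?_
    rw [← lintegral_mul_const _ hk]
    refine setLIntegral_mono' measurableSet_Ioi fun s hs => ?_
    gcongr
    exact le_iSup₂_of_le (t * s) (mul_pos ht hs) le_rfl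
  · have h1 := one_le_toReal hh hht
    set q := h.toReal
    have hq : 0 < q := by positivity
    set K := ∫⁻ s in Set.Ioi (0 : ℝ), k s
    rw [mulNorm_of_ne_top hht hG, mulNorm_of_ne_top hht hmeas.lintegral_prod_right']
    have hpt : ∀ t, (∫⁻ s in Set.Ioi (0 : ℝ), k s * G (t * s)) ^ q ≤
        K ^ (q - 1) * ∫⁻ s in Set.Ioi (0 : ℝ), k s * G (t * s) ^ q := by
      intro t
      have := lintegral_rpow_le_measure_univ_rpow_mul
        ((volume.restrict (Set.Ioi (0 : ℝ))).withDensity k) (hsec t) h1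
      rw [lintegral_withDensity_eq_lintegral_mul _ hk (hsec t),
        lintegral_withDensity_eq_lintegral_mul _ hk ((hsec t).pow_const _)] at this
      simpa [K] using this
    have hmeas' : Measurable fun p : ℝ × ℝ => k p.2 * G (p.1 * p.2) ^ q :=
      (hk.comp measurable_snd).mul ((hG.comp (measurable_fst.mul measurable_snd)).pow_const _)
    have hsf : SFinite haarIoi := by unfold haarIoi; infer_instance
    calc (∫⁻ t, (∫⁻ s in Set.Ioi (0 : ℝ), k s * G (t * s)) ^ q ∂haarIoi) ^ (1 / q)
        ≤ (∫⁻ t, K ^ (q - 1) * (∫⁻ s in Set.Ioi (0 : ℝ), k s * G (t * s) ^ q) ∂haarIoi) ^ (1 / q) :=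
          ENNReal.rpow_le_rpow (lintegral_mono hpt) (by positivity)
      _ = (K ^ (q - 1) * (K * ∫⁻ t, G t ^ q ∂haarIoi)) ^ (1 / q) := by
          have hmi : Measurable fun t => ∫⁻ s in Set.Ioi (0 : ℝ), k s * G (t * s) ^ q :=
            hmeas'.lintegral_prod_right'
          rw [lintegral_const_mul _ hmi, lintegral_lintegral_swap hmeas'.aemeasurable,
            ← lintegral_mul_const _ hk]
          congr 2
          refine setLIntegral_congr_fun measurableSet_Ioi fun s hs => ?_
          have hm : Measurable fun t => G (t * s) ^ q :=
            (hG.comp (measurable_mul_const s)).pow_const _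
          rw [lintegral_const_mul _ hm]
          congr 1
          exact lintegral_haarIoi_comp_mul (hG.pow_const q) hs
      _ = _ := by
          -- Jensen contributes `K ^ (q - 1)` and Tonelli one more `K`, so that the `q`-th root
          -- leaves exactly `K`.
          have hK : K ^ (q - 1) * K = K ^ q := by
            conv_lhs => rw [← ENNReal.rpow_one K, ← ENNReal.rpow_mul, one_mul]
            rw [← ENNReal.rpow_add_of_nonneg _ _ (by linarith) zero_le_one]
            simp
          rw [← mul_assoc, hK, ENNReal.mul_rpow_of_nonneg _ _ (by positivity), ← ENNReal.rpow_mul,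
            mul_one_div_cancel hq.ne', ENNReal.rpow_one]

end MulNorm

/-! ### Hardy's inequalities. -/

section Hardy

theorem ofReal_rpow_mul_rpow_mul {t s a : ℝ} (ht : 0 < t) (hs : 0 < s) :
    ENNReal.ofReal s ^ (-a) * ENNReal.ofReal (t * s) ^ a = ENNReal.ofReal t ^ a := by
  simp only [ENNReal.ofReal_rpow_of_pos, hs, ht, mul_pos]
  rw [← ENNReal.ofReal_mul (by positivity), Real.mul_rpow ht.le hs.le, Real.rpow_neg hs.le]
  congr 1
  field_simp

/-- The constant `∫_0^1 s^{-a} ds` of the first Hardy inequality. -/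
noncomputable def hardyConst (a : ℝ) : ℝ≥0∞ := ∫⁻ s in Set.Ioo (0 : ℝ) 1, ENNReal.ofReal s ^ (-a)

/-- The constant `∫_1^∞ s^{-a-1} ds` of the second Hardy inequality. -/
noncomputable def hardyConst' (a : ℝ) : ℝ≥0∞ :=
  ∫⁻ s in Set.Ioi (1 : ℝ), ENNReal.ofReal s ^ (-(a + 1))

theorem hardyConst_lt_top {a : ℝ} (ha : a < 1) : hardyConst a < ∞ := by
  have h := (intervalIntegral.intervalIntegrable_rpow' (a := 0) (b := 1)
    (r := -a) (by linarith)).1.mono_set Set.Ioo_subset_Ioc_self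
  refine lt_of_eq_of_lt (setLIntegral_congr_fun measurableSet_Ioo fun s hs => ?_) h.lintegral_lt_top
  exact ENNReal.ofReal_rpow_of_pos hs.1

theorem hardyConst'_lt_top {a : ℝ} (ha : 0 < a) : hardyConst' a < ∞ := by
  have h := integrableOn_Ioi_rpow_of_lt (a := -(a + 1)) (c := 1) (by linarith) one_pos
  refine lt_of_eq_of_lt (setLIntegral_congr_fun measurableSet_Ioi fun s hs => ?_) h.lintegral_lt_top
  exact ENNReal.ofReal_rpow_of_pos (zero_lt_one.trans hs)

theorem measurable_ofReal_rpow (a : ℝ) : Measurable fun t : ℝ => ENNReal.ofReal t ^ a :=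
  ENNReal.measurable_ofReal.pow_const a

/-- Rescaling `s` by `t` turns the left side into `∫₀¹ s^{-a} (ts)^a φ(ts) ds`, an average of
dilations of `t^a φ` with kernel `s^{-a}` on `(0, 1)`. -/
theorem mulNorm_hardy_le {h : ℝ≥0∞} (hh : 1 ≤ h) (a : ℝ) {φ : ℝ → ℝ≥0∞} (hφ : Measurable φ) :
    mulNorm h (fun t => ENNReal.ofReal t ^ a *
        ((ENNReal.ofReal t)⁻¹ * ∫⁻ s in Set.Ioo 0 t, φ s)) ≤
      hardyConst a * mulNorm h (fun t => ENNReal.ofReal t ^ a * φ t) := by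
  have hm := (measurable_ofReal_rpow (-a)).indicator (measurableSet_Ioo (a := (0 : ℝ)) (b := 1))
  have hK : ∫⁻ s in Set.Ioi (0 : ℝ), (Set.Ioo (0 : ℝ) 1).indicator
      (fun s => ENNReal.ofReal s ^ (-a)) s = hardyConst a := by
    rw [setLIntegral_indicator measurableSet_Ioo, Set.inter_eq_left.2 Set.Ioo_subset_Ioi_self]
    rfl
  rw [← hK]
  refine le_trans (mulNorm_mono fun t ht => ?_)
    (mulNorm_lintegral_dilation_le hh hm ((measurable_ofReal_rpow a).mul hφ))
  have hpre : (t * ·) ⁻¹' Set.Ioo 0 t = Set.Ioo 0 1 := by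
    ext s
    simp only [Set.mem_preimage, Set.mem_Ioo]
    rw [mul_pos_iff_of_pos_left ht, mul_lt_iff_lt_one_right ht]
  have hmt : Measurable fun s => φ (t * s) := hφ.comp (measurable_const_mul t)
  rw [setLIntegral_eq_mul_setLIntegral_comp_mul hφ measurableSet_Ioo ht, hpre,
    ← mul_assoc _ _ (lintegral _ _),
    ENNReal.inv_mul_cancel (by simpa using ht) ENNReal.ofReal_ne_top, one_mul,
    ← lintegral_const_mul _ hmt]
  have hprod : ∀ s, (Set.Ioo (0 : ℝ) 1).indicator (fun s => ENNReal.ofReal s ^ (-a)) s *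
      (ENNReal.ofReal (t * s) ^ a * φ (t * s)) = (Set.Ioo (0 : ℝ) 1).indicator
        (fun s => ENNReal.ofReal s ^ (-a) * (ENNReal.ofReal (t * s) ^ a * φ (t * s))) s :=
    fun s => (Set.indicator_mul_left _ _
      (fun s => ENNReal.ofReal (t * s) ^ a * φ (t * s))).symm
  simp only [hprod]
  rw [setLIntegral_indicator measurableSet_Ioo, Set.inter_eq_left.2 Set.Ioo_subset_Ioi_self]
  refine (setLIntegral_congr_fun measurableSet_Ioo fun s hs => ?_).le
  rw [← mul_assoc, ofReal_rpow_mul_rpow_mul ht hs.1]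

/-- The same rescaling gives the kernel `s^{-(a+1)}` on `(1, ∞)`, applied to `t^{a+1} φ`. The shift
by one is the Jacobian. -/
theorem mulNorm_hardy'_le {h : ℝ≥0∞} (hh : 1 ≤ h) (a : ℝ) {φ : ℝ → ℝ≥0∞} (hφ : Measurable φ) :
    mulNorm h (fun t => ENNReal.ofReal t ^ a * ∫⁻ s in Set.Ioi t, φ s) ≤
      hardyConst' a * mulNorm h (fun t => ENNReal.ofReal t ^ (a + 1) * φ t) := by
  have hm := (measurable_ofReal_rpow (-(a + 1))).indicator (measurableSet_Ioi (a := (1 : ℝ)))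
  have hsub : Set.Ioi (1 : ℝ) ⊆ Set.Ioi 0 := Set.Ioi_subset_Ioi zero_le_one
  have hK : ∫⁻ s in Set.Ioi (0 : ℝ), (Set.Ioi (1 : ℝ)).indicator
      (fun s => ENNReal.ofReal s ^ (-(a + 1))) s = hardyConst' a := by
    rw [setLIntegral_indicator measurableSet_Ioi, Set.inter_eq_left.2 hsub]
    rfl
  rw [← hK]
  refine le_trans (mulNorm_mono fun t ht => ?_)
    (mulNorm_lintegral_dilation_le hh hm ((measurable_ofReal_rpow (a + 1)).mul hφ))
  have hpre : (t * ·) ⁻¹' Set.Ioi t = Set.Ioi 1 := by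
    ext s
    simp [lt_mul_iff_one_lt_right ht]
  have hmt : Measurable fun s => φ (t * s) := hφ.comp (measurable_const_mul t)
  have hpow : ENNReal.ofReal t ^ a * ENNReal.ofReal t = ENNReal.ofReal t ^ (a + 1) := by
    rw [ENNReal.rpow_add _ _ (by simpa using ht) ENNReal.ofReal_ne_top, ENNReal.rpow_one]
  rw [setLIntegral_eq_mul_setLIntegral_comp_mul hφ measurableSet_Ioi ht, hpre, ← mul_assoc, hpow,
    ← lintegral_const_mul _ hmt]
  have hprod : ∀ s, (Set.Ioi (1 : ℝ)).indicator (fun s => ENNReal.ofReal s ^ (-(a + 1))) s *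
      (ENNReal.ofReal (t * s) ^ (a + 1) * φ (t * s)) = (Set.Ioi (1 : ℝ)).indicator
        (fun s => ENNReal.ofReal s ^ (-(a + 1)) *
          (ENNReal.ofReal (t * s) ^ (a + 1) * φ (t * s))) s :=
    fun s => (Set.indicator_mul_left _ _
      (fun s => ENNReal.ofReal (t * s) ^ (a + 1) * φ (t * s))).symm
  simp only [hprod]
  rw [setLIntegral_indicator measurableSet_Ioi, Set.inter_eq_left.2 hsub]
  refine (setLIntegral_congr_fun measurableSet_Ioi fun s hs => ?_).le
  rw [← mul_assoc, ofReal_rpow_mul_rpow_mul ht (zero_lt_one.trans hs)]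

end Hardy

/-! ### O'Neil's inequality in Lorentz spaces. -/

section ONeil

variable {E : Type*} [MeasurableSpace E] {μ : Measure E} [SFinite μ]

/-- A function of finite Lorentz norm is the sum of an integrable and a bounded function. -/
theorem exists_lintegral_gt_lt_top {h : ℝ≥0∞} (hh : 1 ≤ h) {a : ℝ} (ha : a < 1)
    {F : E → ℝ≥0∞} (hF : Measurable F)
    (hfin : mulNorm h (fun t => ENNReal.ofReal t ^ a * decRearr μ F t) < ∞) :
    ∃ M : ℝ≥0∞, M < ∞ ∧ ∫⁻ x, {x | M < F x}.indicator F x ∂μ < ∞ := by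
  have hmeas : Measurable fun t => ∫⁻ s in Set.Ioo 0 t, decRearr μ F s := by
    refine Monotone.measurable fun t t' htt' => ?_
    exact lintegral_mono_set (Set.Ioo_subset_Ioo_right htt')
  -- Hardy's inequality makes `∫₀ᵗ F^*` finite for some `t`; the truncation height is then `M =
  -- F^*(t)`.
  obtain ⟨t, ht, hlt⟩ := exists_lt_top_of_mulNorm_lt_top hh
    ((measurable_ofReal_rpow a).mul (ENNReal.measurable_ofReal.inv.mul hmeas))
    ((mulNorm_hardy_le hh a (measurable_decRearr F)).trans_lt
      (ENNReal.mul_lt_top (hardyConst_lt_top ha) hfin))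
  have ht0 : ENNReal.ofReal t ≠ 0 := by simpa using ht
  have hI : ∫⁻ s in Set.Ioo 0 t, decRearr μ F s < ∞ := by
    by_contra! hcon
    rw [Pi.mul_apply, Pi.mul_apply, top_le_iff.1 hcon, ENNReal.mul_top (by simp),
      ENNReal.mul_top] at hlt
    · exact hlt.ne rfl
    · simp [ENNReal.rpow_eq_zero_iff, ht0]
  refine ⟨decRearr μ F t, ?_, (setLIntegral_gt_decRearr_le hF t).trans_lt hI⟩
  have := (ofReal_mul_decRearr_le F t).trans_lt hI
  by_contra! hcon
  rw [top_le_iff.1 hcon, ENNReal.mul_top ht0] at this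
  exact this.ne rfl

variable [AddCommGroup E] [MeasurableAdd₂ E] [MeasurableNeg E] [μ.IsAddLeftInvariant]
  [μ.IsNegInvariant]

/-- O'Neil's inequality for convolutions in Lorentz spaces. -/
theorem mulNorm_convolution_le {h h₁ h₂ : ℝ≥0∞} (hh : 1 ≤ h) (hh₁ : 1 ≤ h₁) (hh₂ : 1 ≤ h₂)
    (hhh : h⁻¹ = h₁⁻¹ + h₂⁻¹) {a b c : ℝ} (habc : a + b = c + 1) {F G : E → ℝ≥0∞}
    (hF : Measurable F) (hG : Measurable G) :
    mulNorm h (fun t => ENNReal.ofReal t ^ c *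
        decRearr μ (fun x => ∫⁻ y, F y * G (x - y) ∂μ) t) ≤
      (4 * hardyConst a * hardyConst b + hardyConst' c) *
        (mulNorm h₁ (fun t => ENNReal.ofReal t ^ a * decRearr μ F t) *
          mulNorm h₂ (fun t => ENNReal.ofReal t ^ b * decRearr μ G t)) := by
  have hmeas : ∀ (K : E → ℝ≥0∞) (a : ℝ), Measurable fun t => ENNReal.ofReal t ^ a *
      ((ENNReal.ofReal t)⁻¹ * ∫⁻ s in Set.Ioo 0 t, decRearr μ K s) := by
    intro K a
    refine (measurable_ofReal_rpow a).mul (ENNReal.measurable_ofReal.inv.mul ?_)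
    exact Monotone.measurable fun t t' htt' => lintegral_mono_set (Set.Ioo_subset_Ioo_right htt')
  have hmeas' : Measurable fun t => ENNReal.ofReal t ^ c *
      ∫⁻ s in Set.Ioi t, decRearr μ F s * decRearr μ G s := by
    refine (measurable_ofReal_rpow c).mul (Antitone.measurable fun t t' htt' => ?_)
    exact lintegral_mono_set (Set.Ioi_subset_Ioi htt')
  have hFm := (measurable_ofReal_rpow a).mul (measurable_decRearr (μ := μ) F)
  have hGm := (measurable_ofReal_rpow b).mul (measurable_decRearr (μ := μ) G)
  have hpow : ∀ {x y : ℝ} {t : ℝ}, 0 < t → ENNReal.ofReal t ^ x * ENNReal.ofReal t ^ y =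
      ENNReal.ofReal t ^ (x + y) := fun ht =>
    (ENNReal.rpow_add _ _ (by simpa using ht) ENNReal.ofReal_ne_top).symm
  set A := mulNorm h₁ (fun t => ENNReal.ofReal t ^ a * decRearr μ F t)
  set B := mulNorm h₂ (fun t => ENNReal.ofReal t ^ b * decRearr μ G t)
  calc _ ≤ mulNorm h (fun t => 4 * ((ENNReal.ofReal t ^ a *
        ((ENNReal.ofReal t)⁻¹ * ∫⁻ s in Set.Ioo 0 t, decRearr μ F s)) * (ENNReal.ofReal t ^ b *
        ((ENNReal.ofReal t)⁻¹ * ∫⁻ s in Set.Ioo 0 t, decRearr μ G s))) +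
        ENNReal.ofReal t ^ c * ∫⁻ s in Set.Ioi t, decRearr μ F s * decRearr μ G s) := by
        refine mulNorm_mono fun t ht => ?_
        refine (mul_le_mul_right (decRearr_convolution_le hF hG ht) _).trans_eq ?_
        -- Since `c = a + b - 1`, the weight `t^c t⁻¹` splits into `t^{a-1}` and `t^{b-1}`, one for
        -- each mean.
        have hc : ENNReal.ofReal t ^ c =
            ENNReal.ofReal t ^ a * ENNReal.ofReal t ^ b * (ENNReal.ofReal t)⁻¹ := by
          rw [hpow ht, ← ENNReal.rpow_neg_one, hpow ht, habc, add_neg_cancel_right]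
        rw [mul_add]
        congr 1
        rw [hc]
        ring
    _ ≤ 4 * ((hardyConst a * A) * (hardyConst b * B)) + hardyConst' c * (A * B) := by
        refine (mulNorm_add_le hh (((hmeas F a).mul (hmeas G b)).const_mul 4) hmeas').trans ?_
        gcongr
        · refine (mulNorm_const_mul_le hh ((hmeas F a).mul (hmeas G b)) 4).trans ?_
          gcongr
          refine (mulNorm_mul_le hh hh₁ hh₂ hhh (hmeas F a) (hmeas G b)).trans ?_
          gcongr
          · exact mulNorm_hardy_le hh₁ a (measurable_decRearr F)
          · exact mulNorm_hardy_le hh₂ b (measurable_decRearr G)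
        · refine (mulNorm_hardy'_le hh c
            ((measurable_decRearr F).mul (measurable_decRearr G))).trans ?_
          gcongr
          refine le_trans (mulNorm_mono fun t ht => ?_) (mulNorm_mul_le hh hh₁ hh₂ hhh hFm hGm)
          rw [← habc, ← hpow ht]
          exact le_of_eq (by simp only [Pi.mul_apply]; ring)
    _ = _ := by ring

end ONeil

/-! ### Regularized products on the Fourier side. -/

section Distributions

theorem Represents.congr {d : ℕ} {f g : EuclideanSpace ℝ (Fin d) → ℂ}
    {T : 𝓢'(EuclideanSpace ℝ (Fin d), ℂ)} (hf : Represents f T) (hfg : f =ᵐ[volume] g) :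
    Represents g T := by
  refine ⟨hf.1.congr hfg, fun ψ => ?_⟩
  have h : (fun x => f x * ψ x) =ᵐ[volume] fun x => g x * ψ x :=
    hfg.mono fun x hx => by simp only [hx]
  exact ⟨(hf.2 ψ).1.congr h, (hf.2 ψ).2.trans (integral_congr_ae h)⟩

/-- A measurable function of slow growth in the mean represents a tempered distribution. -/
theorem exists_represents {d : ℕ} {F : EuclideanSpace ℝ (Fin d) → ℂ}
    (hF : AEStronglyMeasurable F volume) (n : ℕ)
    (hn : Integrable (fun x => ‖F x‖ * (1 + ‖x‖) ^ (-(n : ℝ))) volume) :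
    ∃ T : 𝓢'(EuclideanSpace ℝ (Fin d), ℂ), Represents F T := by
  have hbound : ∀ (ψ : 𝓢(EuclideanSpace ℝ (Fin d), ℂ)) x, ‖F x * ψ x‖ ≤
      ‖F x‖ * (1 + ‖x‖) ^ (-(n : ℝ)) * (2 ^ n * ((Finset.Iic (n, 0)).sup
        (schwartzSeminormFamily ℂ (EuclideanSpace ℝ (Fin d)) ℂ) ψ)) := by
    intro ψ x
    rw [norm_mul, mul_assoc]
    gcongr
    rw [Real.rpow_neg (by positivity), ← div_eq_inv_mul, le_div_iff₀' (by positivity),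
      Real.rpow_natCast]
    have h := SchwartzMap.one_add_le_sup_seminorm_apply (𝕜 := ℂ) (m := (n, 0)) (k := n) (n := 0)
      le_rfl le_rfl ψ x
    rw [norm_iteratedFDeriv_zero] at h
    exact h
  have hint : ∀ ψ : 𝓢(EuclideanSpace ℝ (Fin d), ℂ), Integrable (fun x => F x * ψ x) volume :=
    fun ψ => (hn.mul_const _).mono' (hF.mul ψ.continuous.aestronglyMeasurable)
      (Eventually.of_forall (hbound ψ))
  let L : 𝓢(EuclideanSpace ℝ (Fin d), ℂ) →L[ℂ] ℂ :=
    SchwartzMap.mkCLMtoNormedSpace (𝕜 := ℂ) (σ := RingHom.id ℂ) (fun ψ => ∫ x, F x * ψ x)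
      (fun ψ χ => by
        rw [← integral_add (hint ψ) (hint χ)]
        exact integral_congr_ae (Eventually.of_forall fun x => by simp [mul_add]))
      (fun c ψ => by
        rw [smul_eq_mul, ← integral_const_mul]
        exact integral_congr_ae (Eventually.of_forall fun x => by simp [mul_left_comm]))
      ⟨Finset.Iic (n, 0), (∫ x, ‖F x‖ * (1 + ‖x‖) ^ (-(n : ℝ))) * 2 ^ n,
        mul_nonneg (integral_nonneg fun x => by positivity) (by positivity), fun ψ => by
        refine (norm_integral_le_of_norm_le (hn.mul_const _)
          (Eventually.of_forall (hbound ψ))).trans_eq ?_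
        rw [integral_mul_const, mul_assoc]⟩
  exact ⟨L.toPointwiseConvergenceCLM _ _ _ _, hF, fun ψ => ⟨hint ψ, rfl⟩⟩

/-- The Fourier transform of the kernel `y ↦ φ_ε (x - y)`. -/
theorem fourierInv_approxKernel {d : ℕ} (φ : 𝓢(EuclideanSpace ℝ (Fin d), ℂ)) {ε : ℝ} (hε : 0 < ε)
    (x ξ : EuclideanSpace ℝ (Fin d)) :
    (𝓕⁻ (approxKernel φ ε x)) ξ = (𝐞 (inner ℝ x ξ) : ℂ) * (𝓕 φ) (ε • ξ) := by
  rw [SchwartzMap.fourierInv_coe, Real.fourierInv_eq, SchwartzMap.fourier_coe, Real.fourier_eq,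
    ← integral_sub_left_eq_self _ volume x]
  have h := Measure.integral_comp_smul_of_nonneg (volume : Measure (EuclideanSpace ℝ (Fin d)))
    (fun y => (𝐞 (inner ℝ (x - y) ξ)) • approxKernel φ ε x (x - y)) ε (hR := hε.le)
  rw [eq_comm, inv_smul_eq_iff₀ (pow_ne_zero _ hε.ne')] at h
  rw [h, ← integral_const_mul, ← integral_smul]
  refine integral_congr_ae (Eventually.of_forall fun y => ?_)
  simp only [approxKernel_apply φ hε, sub_sub_cancel, smul_smul, inv_mul_cancel₀ hε.ne', one_smul,
    Circle.smul_def, smul_eq_mul, finrank_euclideanSpace_fin, Complex.real_smul, Complex.ofReal_pow]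
  have hE : (𝐞 (inner ℝ (x - ε • y) ξ) : ℂ) =
      (𝐞 (inner ℝ x ξ) : ℂ) * (𝐞 (-inner ℝ y (ε • ξ)) : ℂ) := by
    rw [← Circle.coe_mul, ← AddChar.map_add_eq_mul, inner_sub_left, real_inner_smul_left,
      real_inner_smul_right, sub_eq_add_neg]
  have hεd : (ε : ℂ) ^ d ≠ 0 := pow_ne_zero _ (by exact_mod_cast hε.ne')
  rw [hE]
  field_simp

theorem mollify_eq_integral {d : ℕ} {u : 𝓢'(EuclideanSpace ℝ (Fin d), ℂ)}
    {f : EuclideanSpace ℝ (Fin d) → ℂ} (hf : Represents f (𝓕 u))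
    (φ : 𝓢(EuclideanSpace ℝ (Fin d), ℂ)) {ε : ℝ} (hε : 0 < ε) (x : EuclideanSpace ℝ (Fin d)) :
    mollify φ ε u x = ∫ ξ, f ξ * ((𝐞 (inner ℝ x ξ) : ℂ) * (𝓕 φ) (ε • ξ)) := by
  have h := (hf.2 (𝓕⁻ (approxKernel φ ε x))).2
  rw [TemperedDistribution.fourier_apply, FourierTransform.fourier_fourierInv_eq] at h
  rw [mollify, h]
  simp_rw [fourierInv_approxKernel φ hε]

theorem Represents.integrable_mul_fourier_smul {d : ℕ} {u : 𝓢'(EuclideanSpace ℝ (Fin d), ℂ)}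
    {f : EuclideanSpace ℝ (Fin d) → ℂ} (hf : Represents f (𝓕 u))
    (φ : 𝓢(EuclideanSpace ℝ (Fin d), ℂ)) {ε : ℝ} (hε : 0 < ε) :
    Integrable (fun ξ => f ξ * (𝓕 φ) (ε • ξ)) volume := by
  have h := (hf.2 (𝓕⁻ (approxKernel φ ε 0))).1
  simpa [fourierInv_approxKernel φ hε] using h

/-- The regularized product on the Fourier side. -/
theorem integral_mollify_mul_mollify {d : ℕ} {u v : 𝓢'(EuclideanSpace ℝ (Fin d), ℂ)}
    {f g : EuclideanSpace ℝ (Fin d) → ℂ} (hf : Represents f (𝓕 u)) (hg : Represents g (𝓕 v))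
    (φ ψ : 𝓢(EuclideanSpace ℝ (Fin d), ℂ)) {ε : ℝ} (hε : 0 < ε) :
    ∫ x, mollify φ ε u x * mollify φ ε v x * ψ x =
      ∫ z : EuclideanSpace ℝ (Fin d) × EuclideanSpace ℝ (Fin d),
        f z.1 * (𝓕 φ) (ε • z.1) * (g z.2 * (𝓕 φ) (ε • z.2)) * (𝓕⁻ ψ) (z.1 + z.2) := by
  have hA := (hf.integrable_mul_fourier_smul φ hε).mul_prod (hg.integrable_mul_fourier_smul φ hε)
  set A : EuclideanSpace ℝ (Fin d) × EuclideanSpace ℝ (Fin d) → ℂ := fun z =>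
    f z.1 * (𝓕 φ) (ε • z.1) * (g z.2 * (𝓕 φ) (ε • z.2))
  have h1 : ∀ x, mollify φ ε u x * mollify φ ε v x * ψ x =
      ∫ z, (𝐞 (inner ℝ x (z.1 + z.2)) : ℂ) * (ψ x * A z) := by
    intro x
    rw [mollify_eq_integral hf φ hε, mollify_eq_integral hg φ hε, ← integral_prod_mul,
      ← integral_mul_const]
    refine integral_congr_ae (Eventually.of_forall fun z => ?_)
    simp only [A, inner_add_right, AddChar.map_add_eq_mul, Circle.coe_mul]
    ring
  -- Fubini applies because the integrand is a unimodular character times the tensor product of the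
  -- integrable functions `ψ` and `A`.
  have hint : Integrable (Function.uncurry fun x (z : EuclideanSpace ℝ (Fin d) ×
      EuclideanSpace ℝ (Fin d)) => (𝐞 (inner ℝ x (z.1 + z.2)) : ℂ) * (ψ x * A z))
      (volume.prod volume) := by
    refine (ψ.integrable.mul_prod hA).bdd_mul (c := 1) ?_ ?_
    · refine Continuous.aestronglyMeasurable ?_
      exact continuous_subtype_val.comp (Real.continuous_fourierChar.comp (by fun_prop))
    · exact Eventually.of_forall fun p => (Circle.norm_coe _).le
  simp_rw [h1]
  rw [integral_integral_swap hint]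
  refine integral_congr_ae (Eventually.of_forall fun z => ?_)
  simp only
  rw [SchwartzMap.fourierInv_coe, Real.fourierInv_eq, ← integral_const_mul]
  refine integral_congr_ae (Eventually.of_forall fun x => ?_)
  simp only [Circle.smul_def, smul_eq_mul]
  ring

end Distributions

/-! ### Integrability of the convolution against a test function. -/

section Convolution

variable {E : Type*} [MeasurableSpace E] {μ : Measure E}

/-- Pointwise, `H K` is at most `B H` where `H > M`, and at most `M K` elsewhere. -/
theorem lintegral_mul_lt_top_of_gt {H K : E → ℝ≥0∞} (hH : Measurable H) (hK : Measurable K)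
    {M B : ℝ≥0∞} (hM : M < ∞) (hB : B < ∞) (hKB : ∀ x, K x ≤ B)
    (hHM : ∫⁻ x, {x | M < H x}.indicator H x ∂μ < ∞) (hKint : ∫⁻ x, K x ∂μ < ∞) :
    ∫⁻ x, H x * K x ∂μ < ∞ := by
  have hm : Measurable ({x | M < H x}.indicator H) :=
    hH.indicator (measurableSet_lt measurable_const hH)
  calc ∫⁻ x, H x * K x ∂μ ≤ ∫⁻ x, ({x | M < H x}.indicator H x * B + M * K x) ∂μ := by
        refine lintegral_mono fun x => ?_
        by_cases hx : M < H x
        · simp only [Set.indicator, Set.mem_ofPred_eq, hx, if_true]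
          exact le_add_right (by gcongr; exact hKB x)
        · exact le_add_left (by gcongr; exact not_lt.1 hx)
    _ = (∫⁻ x, {x | M < H x}.indicator H x ∂μ) * B + M * ∫⁻ x, K x ∂μ := by
        rw [lintegral_add_right _ (hK.const_mul M), lintegral_mul_const _ hm,
          lintegral_const_mul _ hK]
    _ < ∞ := ENNReal.add_lt_top.2 ⟨ENNReal.mul_lt_top hHM hB, ENNReal.mul_lt_top hM hKint⟩

variable [AddCommGroup E] [MeasurableAdd₂ E] [MeasurableNeg E]

theorem integrable_convolution_kernel [SFinite μ] {f g K : E → ℂ} (hf : Measurable f)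
    (hg : Measurable g) (hK : Measurable K)
    (hfin : ∫⁻ x, (∫⁻ y, ‖f y‖ₑ * ‖g (x - y)‖ₑ ∂μ) * ‖K x‖ₑ ∂μ < ∞) :
    Integrable (fun p : E × E => f p.2 * g (p.1 - p.2) * K p.1) (μ.prod μ) := by
  have hm : Measurable fun p : E × E => f p.2 * g (p.1 - p.2) * K p.1 :=
    ((hf.comp measurable_snd).mul (hg.comp (measurable_fst.sub measurable_snd))).mul
      (hK.comp measurable_fst)
  refine ⟨hm.aestronglyMeasurable, ?_⟩
  rw [hasFiniteIntegral_iff_enorm, lintegral_prod _ hm.enorm.aemeasurable]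
  refine lt_of_eq_of_lt (lintegral_congr fun x => ?_) hfin
  have hmx : Measurable fun y => ‖f y‖ₑ * ‖g (x - y)‖ₑ :=
    hf.enorm.mul (hg.comp (measurable_id.const_sub x)).enorm
  simp_rw [enorm_mul]
  rw [lintegral_mul_const _ hmx]

theorem integrable_mul_mul_comp_add [SFinite μ] [μ.IsAddLeftInvariant] {f g K : E → ℂ}
    (hf : Measurable f) (hg : Measurable g) (hK : Measurable K)
    (hfin : ∫⁻ x, (∫⁻ y, ‖f y‖ₑ * ‖g (x - y)‖ₑ ∂μ) * ‖K x‖ₑ ∂μ < ∞) :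
    Integrable (fun z : E × E => f z.1 * g z.2 * K (z.1 + z.2)) (μ.prod μ) := by
  have hm : Measurable fun z : E × E => f z.1 * g z.2 * K (z.1 + z.2) :=
    ((hf.comp measurable_fst).mul (hg.comp measurable_snd)).mul
      (hK.comp (measurable_fst.add measurable_snd))
  have hi := (integrable_convolution_kernel hf hg hK hfin).swap
  refine ⟨hm.aestronglyMeasurable, ?_⟩
  have hi2 := hi.2
  rw [hasFiniteIntegral_iff_enorm, lintegral_prod _ hi.1.enorm] at hi2
  rw [hasFiniteIntegral_iff_enorm, lintegral_prod _ hm.enorm.aemeasurable]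
  refine lt_of_eq_of_lt (lintegral_congr fun y => ?_) hi2
  -- The shear `(x, y) ↦ (y, x - y)` preserves the product measure; here it is a translation of the
  -- inner variable for fixed `y`.
  rw [← lintegral_sub_right_eq_self _ y]
  simp

theorem integral_mul_mul_comp_add [SFinite μ] [μ.IsAddLeftInvariant] {f g K : E → ℂ}
    (hf : Measurable f) (hg : Measurable g) (hK : Measurable K)
    (hfin : ∫⁻ x, (∫⁻ y, ‖f y‖ₑ * ‖g (x - y)‖ₑ ∂μ) * ‖K x‖ₑ ∂μ < ∞) :
    ∫ z : E × E, f z.1 * g z.2 * K (z.1 + z.2) ∂μ.prod μ =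
      ∫ x, (∫ y, f y * g (x - y) ∂μ) * K x ∂μ := by
  have hi := integrable_convolution_kernel hf hg hK hfin
  rw [integral_prod _ (integrable_mul_mul_comp_add hf hg hK hfin)]
  simp_rw [← integral_mul_const]
  rw [integral_integral_swap (f := fun x y => f y * g (x - y) * K x) hi]
  refine integral_congr_ae (Eventually.of_forall fun y => ?_)
  simp only
  rw [← integral_sub_right_eq_self _ y]
  simp

end Convolution

/-! ### Existence of the product. -/

section Product

/-- Dominated convergence: `φ̂(εξ)` tends to `φ̂(0) = ∫ φ = 1` and stays below `B`, so `B²` times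
the limiting integrand dominates. -/
theorem Represents.tendsto_integral_mollify {d : ℕ} {u v : 𝓢'(EuclideanSpace ℝ (Fin d), ℂ)}
    {f g : EuclideanSpace ℝ (Fin d) → ℂ} (hfm : Measurable f) (hgm : Measurable g)
    (hf : Represents f (𝓕 u)) (hg : Represents g (𝓕 v))
    {φ ψ : 𝓢(EuclideanSpace ℝ (Fin d), ℂ)} (hφ : ∫ x, φ x = 1)
    (hfin : ∫⁻ x, (∫⁻ y, ‖f y‖ₑ * ‖g (x - y)‖ₑ) * ‖(𝓕⁻ ψ) x‖ₑ < ∞) :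
    Tendsto (fun ε : ℝ => ∫ x, mollify φ ε u x * mollify φ ε v x * ψ x) (𝓝[>] 0)
      (𝓝 (∫ x, (∫ y, f y * g (x - y)) * (𝓕⁻ ψ) x)) := by
  have hKm := (𝓕⁻ ψ).continuous.measurable
  have hφm := (𝓕 φ).continuous.measurable
  obtain ⟨B, hB⟩ : ∃ B, ∀ ξ, ‖(𝓕 φ) ξ‖ ≤ B :=
    ⟨_, fun ξ => SchwartzMap.norm_le_seminorm ℝ (𝓕 φ) ξ⟩
  have hφ0 : (𝓕 φ) 0 = 1 := by
    rw [SchwartzMap.fourier_coe, Real.fourier_eq, ← hφ]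
    simp
  have hlim : ∀ ξ : EuclideanSpace ℝ (Fin d),
      Tendsto (fun ε : ℝ => (𝓕 φ) (ε • ξ)) (𝓝[>] 0) (𝓝 1) := by
    intro ξ
    have hc : Continuous fun ε : ℝ => (𝓕 φ) (ε • ξ) :=
      (𝓕 φ).continuous.comp (continuous_id.smul continuous_const)
    have := hc.tendsto 0
    rw [zero_smul, hφ0] at this
    exact this.mono_left nhdsWithin_le_nhds
  rw [← integral_mul_mul_comp_add hfm hgm hKm hfin]
  have hev : (fun ε : ℝ => ∫ z : EuclideanSpace ℝ (Fin d) × EuclideanSpace ℝ (Fin d),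
      f z.1 * (𝓕 φ) (ε • z.1) * (g z.2 * (𝓕 φ) (ε • z.2)) * (𝓕⁻ ψ) (z.1 + z.2)) =ᶠ[𝓝[>] 0]
      fun ε : ℝ => ∫ x, mollify φ ε u x * mollify φ ε v x * ψ x := by
    filter_upwards [self_mem_nhdsWithin] with ε hε
    exact (integral_mollify_mul_mollify hf hg φ ψ hε).symm
  refine Tendsto.congr' hev ?_
  refine tendsto_integral_filter_of_dominated_convergence
    (fun z => B * B * ‖f z.1 * g z.2 * (𝓕⁻ ψ) (z.1 + z.2)‖) ?_ ?_ ?_ ?_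
  · refine Eventually.of_forall fun ε => Measurable.aestronglyMeasurable ?_
    exact (((hfm.comp measurable_fst).mul (hφm.comp (measurable_fst.const_smul ε))).mul
      ((hgm.comp measurable_snd).mul (hφm.comp (measurable_snd.const_smul ε)))).mul
      (hKm.comp (measurable_fst.add measurable_snd))
  · refine Eventually.of_forall fun ε => Eventually.of_forall fun z => ?_
    calc _ = ‖(𝓕 φ) (ε • z.1)‖ * ‖(𝓕 φ) (ε • z.2)‖ * ‖f z.1 * g z.2 * (𝓕⁻ ψ) (z.1 + z.2)‖ := by
          simp only [norm_mul]
          ring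
      _ ≤ _ := by
          gcongr
          · exact (norm_nonneg _).trans (hB 0)
          · exact hB _
          · exact hB _
  · exact (integrable_mul_mul_comp_add hfm hgm hKm hfin).norm.const_mul _
  · refine Eventually.of_forall fun z => ?_
    have := (((tendsto_const_nhds (x := f z.1)).mul (hlim z.1)).mul
      ((tendsto_const_nhds (x := g z.2)).mul (hlim z.2))).mul
      (tendsto_const_nhds (x := (𝓕⁻ ψ) (z.1 + z.2)))
    simpa using this

/-- If the convolution of the Fourier transforms of `u` and `v` is the sum of an integrable and a
bounded function, then the product `u v` exists, and this convolution is its Fourier transform. -/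
theorem exists_isProduct {d : ℕ} {u v : 𝓢'(EuclideanSpace ℝ (Fin d), ℂ)}
    {f g : EuclideanSpace ℝ (Fin d) → ℂ} (hfm : Measurable f) (hgm : Measurable g)
    (hf : Represents f (𝓕 u)) (hg : Represents g (𝓕 v)) {M : ℝ≥0∞} (hM : M < ∞)
    (hint : ∫⁻ x, {x | M < ∫⁻ y, ‖f y‖ₑ * ‖g (x - y)‖ₑ}.indicator
      (fun x => ∫⁻ y, ‖f y‖ₑ * ‖g (x - y)‖ₑ) x < ∞) :
    ∃ w : 𝓢'(EuclideanSpace ℝ (Fin d), ℂ), IsProduct u v w ∧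
      Represents (fun x => ∫ y, f y * g (x - y)) (𝓕 w) := by
  have hHm : Measurable fun x => ∫⁻ y, ‖f y‖ₑ * ‖g (x - y)‖ₑ :=
    Measurable.lintegral_prod_right'
      (f := fun p : EuclideanSpace ℝ (Fin d) × EuclideanSpace ℝ (Fin d) =>
        ‖f p.2‖ₑ * ‖g (p.1 - p.2)‖ₑ)
      ((hfm.comp measurable_snd).enorm.mul (hgm.comp (measurable_fst.sub measurable_snd)).enorm)
  have hFm : StronglyMeasurable fun x => ∫ y, f y * g (x - y) :=
    StronglyMeasurable.integral_prod_right'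
      (f := fun p : EuclideanSpace ℝ (Fin d) × EuclideanSpace ℝ (Fin d) => f p.2 * g (p.1 - p.2))
      ((hfm.comp measurable_snd).mul
        (hgm.comp (measurable_fst.sub measurable_snd))).stronglyMeasurable
  have hFH : ∀ x, ‖∫ y, f y * g (x - y)‖ₑ ≤ ∫⁻ y, ‖f y‖ₑ * ‖g (x - y)‖ₑ := fun x =>
    (enorm_integral_le_lintegral_enorm _).trans_eq (lintegral_congr fun y => enorm_mul _ _)
  -- The weight `(1 + ‖x‖)^{-(d+1)}` is both integrable and bounded by `1`, as needed for the
  -- bounded and the integrable part of the convolution respectively.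
  obtain ⟨T, hT⟩ := exists_represents hFm.aestronglyMeasurable (d + 1) (by
    have hJ : Integrable (fun x : EuclideanSpace ℝ (Fin d) => (1 + ‖x‖) ^ (-((d + 1 : ℕ) : ℝ)))
        volume := integrable_one_add_norm (by simp)
    have hJm : Measurable fun x : EuclideanSpace ℝ (Fin d) => (1 + ‖x‖) ^ (-((d + 1 : ℕ) : ℝ)) := by
      fun_prop
    refine ⟨hFm.aestronglyMeasurable.norm.mul hJm.aestronglyMeasurable, ?_⟩
    rw [hasFiniteIntegral_iff_enorm]
    refine lt_of_le_of_lt (lintegral_mono fun x => ?_) (lintegral_mul_lt_top_of_gt hHm hJm.enorm hM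
      ENNReal.one_lt_top (fun x => ?_) hint hJ.2)
    · rw [enorm_mul, enorm_norm]
      gcongr
      exact hFH x
    · rw [Real.enorm_of_nonneg (by positivity)]
      refine ENNReal.ofReal_le_one.2 (Real.rpow_le_one_of_one_le_of_nonpos ?_ ?_)
      · simp
      · simp only [Left.neg_nonpos_iff]
        positivity)
  refine ⟨𝓕⁻ T, fun φ hφ ψ => ?_, by rwa [FourierTransform.fourier_fourierInv_eq]⟩
  rw [TemperedDistribution.fourierInv_apply, (hT.2 _).2]
  refine hf.tendsto_integral_mollify hfm hgm hg hφ ?_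
  refine lintegral_mul_lt_top_of_gt hHm (𝓕⁻ ψ).continuous.measurable.enorm hM
    (B := ENNReal.ofReal (SchwartzMap.seminorm ℝ 0 0 (𝓕⁻ ψ))) ENNReal.ofReal_lt_top
    (fun x => ?_) hint (𝓕⁻ ψ).integrable.2
  rw [← ofReal_norm]
  exact ENNReal.ofReal_le_ofReal (SchwartzMap.norm_le_seminorm ℝ _ x)

end Product

/-! ### Hölder's inequality for given representatives. -/

section Holder

theorem toReal_inv_conjExponent {p : ℝ≥0∞} (hp : 1 ≤ p) :
    (p.conjExponent⁻¹).toReal = 1 - (p⁻¹).toReal := by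
  have : p.HolderConjugate p.conjExponent := ENNReal.HolderConjugate.conjExponent hp
  have h := ENNReal.HolderConjugate.inv_add_inv_eq_one p p.conjExponent
  have h1 : p⁻¹ ≠ ∞ := ne_top_of_le_ne_top ENNReal.one_ne_top (h ▸ le_self_add)
  have h2 : p.conjExponent⁻¹ ≠ ∞ := ne_top_of_le_ne_top ENNReal.one_ne_top (h ▸ le_add_self)
  have := congrArg ENNReal.toReal h
  rw [ENNReal.toReal_add h1 h2, ENNReal.toReal_one] at this
  linarith

theorem toReal_inv_mem_Ioo {p : ℝ≥0∞} (hp : 1 < p) (hp' : p < ∞) :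
    (p⁻¹).toReal ∈ Set.Ioo (0 : ℝ) 1 := by
  refine ⟨ENNReal.toReal_pos (by simpa using hp'.ne) (by simpa using (zero_lt_one.trans hp).ne'),
    ?_⟩
  simpa using (ENNReal.toReal_lt_toReal (by simpa using (zero_lt_one.trans hp).ne')
    ENNReal.one_ne_top).2 (ENNReal.inv_lt_one.2 hp)

theorem lorentzNorm_mono {d : ℕ} {p h : ℝ≥0∞} {f : EuclideanSpace ℝ (Fin d) → ℂ}
    {H : EuclideanSpace ℝ (Fin d) → ℝ≥0∞} (hfH : ∀ x, ‖f x‖ₑ ≤ H x) :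
    lorentzNorm p h f ≤
      mulNorm h fun t => ENNReal.ofReal t ^ (p⁻¹).toReal * decRearr volume H t := by
  rw [lorentzNorm_eq_mulNorm]
  refine mulNorm_mono fun t _ => ?_
  gcongr
  exact decRearr_mono_ae (Eventually.of_forall hfH) t

theorem lorentzNorm_congr_ae {d : ℕ} {p h : ℝ≥0∞} {f g : EuclideanSpace ℝ (Fin d) → ℂ}
    (hfg : f =ᵐ[volume] g) : lorentzNorm p h f = lorentzNorm p h g := by
  have henorm : (fun x => ‖f x‖ₑ) =ᵐ[volume] fun x => ‖g x‖ₑ := hfg.mono fun x hx => by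
    simp only [hx]
  rw [lorentzNorm_eq_mulNorm, lorentzNorm_eq_mulNorm, decRearr_congr_ae henorm]

/-- The product of two distributions whose Fourier transforms are given functions in Lorentz
spaces. -/
theorem exists_isProduct_lorentzNorm_le {r q₁ q₂ h h₁ h₂ : ℝ≥0∞}
    (hr : 1 < r) (hr_top : r < ∞) (hq₁ : 1 < q₁) (hq₁_top : q₁ < ∞)
    (hq₂ : 1 < q₂) (hq₂_top : q₂ < ∞) (hh : 1 ≤ h) (hh₁ : 1 ≤ h₁) (hh₂ : 1 ≤ h₂)
    (hrq : r⁻¹ = q₁⁻¹ + q₂⁻¹) (hhh : h⁻¹ = h₁⁻¹ + h₂⁻¹) :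
    ∃ C : ℝ≥0, ∀ (d : ℕ) (u v : 𝓢'(EuclideanSpace ℝ (Fin d), ℂ))
      (f g : EuclideanSpace ℝ (Fin d) → ℂ),
      Represents f (𝓕 u) → Represents g (𝓕 v) → lorentzNorm q₁.conjExponent h₁ f < ∞ →
      lorentzNorm q₂.conjExponent h₂ g < ∞ →
        ∃ w : 𝓢'(EuclideanSpace ℝ (Fin d), ℂ), IsProduct u v w ∧
          ∃ F : EuclideanSpace ℝ (Fin d) → ℂ, Represents F (𝓕 w) ∧
            lorentzNorm r.conjExponent h F ≤ C * (lorentzNorm q₁.conjExponent h₁ f *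
              lorentzNorm q₂.conjExponent h₂ g) := by
  set a := (q₁.conjExponent⁻¹).toReal with ha
  set b := (q₂.conjExponent⁻¹).toReal with hb
  set c := (r.conjExponent⁻¹).toReal with hc
  have hq₁' := toReal_inv_mem_Ioo hq₁ hq₁_top
  have hq₂' := toReal_inv_mem_Ioo hq₂ hq₂_top
  have hr' := toReal_inv_mem_Ioo hr hr_top
  have hsum : (r⁻¹).toReal = (q₁⁻¹).toReal + (q₂⁻¹).toReal := by
    rw [hrq, ENNReal.toReal_add (by simpa using (zero_lt_one.trans hq₁).ne')
      (by simpa using (zero_lt_one.trans hq₂).ne')]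
  rw [toReal_inv_conjExponent hq₁.le] at ha
  rw [toReal_inv_conjExponent hq₂.le] at hb
  rw [toReal_inv_conjExponent hr.le] at hc
  have ha1 : a < 1 := by linarith [hq₁'.1]
  have hb1 : b < 1 := by linarith [hq₂'.1]
  have hc0 : 0 < c := by linarith [hr'.2]
  have hc1 : c < 1 := by linarith [hr'.1]
  have hC : 4 * hardyConst a * hardyConst b + hardyConst' c < ∞ :=
    ENNReal.add_lt_top.2 ⟨ENNReal.mul_lt_top (ENNReal.mul_lt_top (by simp) (hardyConst_lt_top ha1))
      (hardyConst_lt_top hb1), hardyConst'_lt_top hc0⟩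
  refine ⟨(4 * hardyConst a * hardyConst b + hardyConst' c).toNNReal,
    fun d u v f g hf hg hfN hgN => ?_⟩
  rw [ENNReal.coe_toNNReal hC.ne]
  -- A measurable representative may be chosen, since both the Lorentz norm and the represented
  -- distribution depend only on the class modulo null sets.
  wlog hfm : Measurable f generalizing f
  · rw [lorentzNorm_congr_ae hf.1.ae_eq_mk] at hfN ⊢
    exact this _ (hf.congr hf.1.ae_eq_mk) hfN hf.1.stronglyMeasurable_mk.measurable
  wlog hgm : Measurable g generalizing g
  · rw [lorentzNorm_congr_ae hg.1.ae_eq_mk] at hgN ⊢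
    exact this _ (hg.congr hg.1.ae_eq_mk) hgN hg.1.stronglyMeasurable_mk.measurable
  have hHm : Measurable fun x => ∫⁻ y, ‖f y‖ₑ * ‖g (x - y)‖ₑ :=
    Measurable.lintegral_prod_right'
      (f := fun p : EuclideanSpace ℝ (Fin d) × EuclideanSpace ℝ (Fin d) =>
        ‖f p.2‖ₑ * ‖g (p.1 - p.2)‖ₑ)
      ((hfm.comp measurable_snd).enorm.mul (hgm.comp (measurable_fst.sub measurable_snd)).enorm)
  have hON := mulNorm_convolution_le (μ := (volume : Measure (EuclideanSpace ℝ (Fin d))))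
    hh hh₁ hh₂ hhh (a := a) (b := b) (c := c) (by linarith) hfm.enorm hgm.enorm
  obtain ⟨M, hM, hint⟩ := exists_lintegral_gt_lt_top hh hc1 hHm
    (hON.trans_lt (ENNReal.mul_lt_top hC (ENNReal.mul_lt_top hfN hgN)))
  obtain ⟨w, hw, hwF⟩ := exists_isProduct hfm hgm hf hg hM hint
  refine ⟨w, hw, _, hwF, (lorentzNorm_mono fun x => ?_).trans hON⟩
  exact (enorm_integral_le_lintegral_enorm _).trans_eq (lintegral_congr fun y => enorm_mul _ _)

end Holder

end FourierLorentz


/-! ### Passage to the Fourier–Lorentz norms. -/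

theorem theorem2p1 (d : ℕ) (hd : 1 ≤ d) (r q₁ q₂ h h₁ h₂ : ℝ≥0∞)
    (hr : 1 < r) (hr_top : r < ∞) (hq₁ : 1 < q₁) (hq₁_top : q₁ < ∞)
    (hq₂ : 1 < q₂) (hq₂_top : q₂ < ∞) (hh : 1 ≤ h) (hh₁ : 1 ≤ h₁) (hh₂ : 1 ≤ h₂)
    (hrq : r⁻¹ = q₁⁻¹ + q₂⁻¹) (hhh : h⁻¹ = h₁⁻¹ + h₂⁻¹) :
    ∃ C : ℝ≥0, ∀ u v : 𝓢'(EuclideanSpace ℝ (Fin d), ℂ),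
      FourierLorentz.MemFourierLorentz q₁ h₁ u → FourierLorentz.MemFourierLorentz q₂ h₂ v →
        ∃ w : 𝓢'(EuclideanSpace ℝ (Fin d), ℂ), FourierLorentz.IsProduct u v w ∧
          FourierLorentz.MemFourierLorentz r h w ∧
          FourierLorentz.fourierLorentzNorm r h w ≤
            C * FourierLorentz.fourierLorentzNorm q₁ h₁ u *
              FourierLorentz.fourierLorentzNorm q₂ h₂ v := by
  obtain ⟨C, hC⟩ := FourierLorentz.exists_isProduct_lorentzNorm_le hr hr_top hq₁ hq₁_top hq₂
    hq₂_top hh hh₁ hh₂ hrq hhh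
  refine ⟨C, fun u v hu hv => ?_⟩
  obtain ⟨f, hfL, hf⟩ := hu
  obtain ⟨g, hgL, hg⟩ := hv
  obtain ⟨w, hw, F, hF, hle⟩ := hC d u v f g hf hg hfL.2 hgL.2
  refine ⟨w, hw, ⟨F, ⟨hF.1, hle.trans_lt (ENNReal.mul_lt_top ENNReal.coe_lt_top
    (ENNReal.mul_lt_top hfL.2 hgL.2))⟩, hF⟩, ?_⟩
  have hA : FourierLorentz.fourierLorentzNorm q₁ h₁ u < ∞ := (iInf₂_le f hf).trans_lt hfL.2
  have hB : FourierLorentz.fourierLorentzNorm q₂ h₂ v < ∞ := (iInf₂_le g hg).trans_lt hgL.2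
  -- The norms are infima over representatives. Nearly optimal ones yield a product that must
  -- coincide with `w` by `IsProduct.unique`, so equality of the norms of different representatives
  -- is never needed.
  have hpair : ∀ a, FourierLorentz.fourierLorentzNorm q₁ h₁ u < a →
      ∀ b, FourierLorentz.fourierLorentzNorm q₂ h₂ v < b →
        FourierLorentz.fourierLorentzNorm r h w ≤ C * (a * b) := by
    intro a ha b hb
    simp only [FourierLorentz.fourierLorentzNorm, iInf_lt_iff] at ha hb
    obtain ⟨f', hf', hfa⟩ := ha
    obtain ⟨g', hg', hgb⟩ := hb
    obtain ⟨w', hw', F', hF', hle'⟩ := hC d u v f' g' hf' hg' hfa.lt_top hgb.lt_top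
    rw [hw.unique hw']
    refine (iInf₂_le F' hF').trans (hle'.trans ?_)
    gcongr
  -- Letting `a` and `b` decrease to the two norms finishes the proof; finiteness of both norms
  -- avoids the discontinuity of multiplication at `0 * ∞`.
  have hcont : Tendsto (fun p : ℝ≥0∞ × ℝ≥0∞ => C * (p.1 * p.2))
      (𝓝[>] (FourierLorentz.fourierLorentzNorm q₁ h₁ u) ×ˢ
        𝓝[>] (FourierLorentz.fourierLorentzNorm q₂ h₂ v))
      (𝓝 (C * (FourierLorentz.fourierLorentzNorm q₁ h₁ u *
        FourierLorentz.fourierLorentzNorm q₂ h₂ v))) := by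
    refine ENNReal.Tendsto.const_mul ?_ (Or.inr ENNReal.coe_ne_top)
    exact ENNReal.Tendsto.mul (tendsto_fst.mono_right nhdsWithin_le_nhds) (Or.inr hB.ne)
      (tendsto_snd.mono_right nhdsWithin_le_nhds) (Or.inr hA.ne)
  have : (𝓝[>] (FourierLorentz.fourierLorentzNorm q₁ h₁ u)).NeBot := nhdsGT_neBot_of_exists_gt
    ⟨∞, hA⟩
  have : (𝓝[>] (FourierLorentz.fourierLorentzNorm q₂ h₂ v)).NeBot := nhdsGT_neBot_of_exists_gt
    ⟨∞, hB⟩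
  rw [mul_assoc]
  refine ge_of_tendsto hcont ?_
  filter_upwards [prod_mem_prod self_mem_nhdsWithin self_mem_nhdsWithin] with p hp
  exact hpair _ hp.1 _ hp.2
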